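/- For integers $0\le m,n\le N$ let $\mathrm{Hyp}(m,n,N)$ be the law of the number $W$ of balls in the first $n$ of $N$ urns when $m$ balls are placed uniformly at random into the $N$ urns, at most one ball per urn, i.e. $\mathbb P[W=k]=\binom nk\binom{N-n}{m-k}/\binom Nm$. For $\mu\in\mathbb R$ and $\sigma^2\ge 0$ put $\gamma=(\mu-\sigma^2)-\lfloor\mu-\sigma^2\rfloor$ and let $\mathrm{TP}(\mu,\sigma^2)$ be the law of $Y$ when $Y-\mu+\sigma^2+\gamma\sim\mathrm{Po}(\sigma^2+\gamma)$. For probability distributions $P,Q$ on $\mathbb Z$ let $d_{\mathrm{TV}}(P,Q)=\sup_{A\subset\mathbb Z}|P(A)-Q(A)|$ and $d_{\mathrm{loc}}(P,Q)=\sup_{k\in\mathbb Z}|P\{k\}-Q\{k\}|$. **Theorem 4.2.** (i) Let $0<m<N$, $0<n<N$, and let $\mu$ and $\sigma^2$ be the mean and the variance of $\mathrm{Hyp}(m,n,N)$. Then $$\sigma^2=\frac{nm(N-n)(N-m)}{(N-1)N^2}.$$ Put $\lambda=\frac{N}{m(N-m+1)}$; then $\lambda>0$, and $\lambda<1$ if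 $m\ge2$. There is an exchangeable pair $(W,W')$ of integer valued random variables with $\mathcal L(W)=\mathrm{Hyp}(m,n,N)$ such that, almost surely, $$\mathbb E[W'-\mu\mid W]=(1-\lambda)(W-\mu)\quad\text{and}\quad W'-W\in\{-1,0,1\},$$ and such that, with $S=\mathbb P[W'=W+1\mid W]$ and $q_{\max}=\max_{k\in\mathbb Z}\mathbb P[W=k]$, $$d_{\mathrm{TV}}(\mathcal L(W),\mathrm{TP}(\mu,\sigma^2))\le\frac{\sqrt{\operatorname{Var}S}}{\lambda\sigma^2}+\frac{2}{\sigma^2},\qquad d_{\mathrm{loc}}(\mathcal L(W),\mathrm{TP}(\mu,\sigma^2))\le\frac{2\sqrt{q_{\max}\operatorname{Var}S}}{\lambda\sigma^2}+\frac{2}{\sigma^2},$$ $$\operatorname{Var}S\le\frac{nm(m+n)^2(N-n)(N-m)}{m^2(N-m+1)^2(N-1)N^2}.$$ (ii) Let $N=N(n)$ and $m=m(n)$ be integers with $n\le N$, $0\le m\le N$ for all large $n$, and suppose that $N\asymp n$, $m\asymp n$ and $\sigma^2\asymp n$ as $n\to\infty$, where $\mu=\mu(n)$ and $\sigma^2=\sigma^2(n)$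 are the mean and the variance of $\mathrm{Hyp}(m,n,N)$. Then, as $n\to\infty$, $$d_{\mathrm{TV}}(\mathrm{Hyp}(m,n,N),\mathrm{TP}(\mu,\sigma^2))=O(n^{-1/2}),\qquad d_{\mathrm{loc}}(\mathrm{Hyp}(m,n,N),\mathrm{TP}(\mu,\sigma^2))=O(n^{-1}).$$ -/

import Mathlib

open MeasureTheory ProbabilityTheory Filter Asymptotics

noncomputable section

/-- The hypergeometric distribution `Hyp(m, n, N)` as a measure on `ℤ` (for `m, n ≤ N`): the law of
the number of balls in the first `n` of `N` urns, when `m` balls are put uniformly at random into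
the `N` urns, at most one ball per urn. Its point probabilities are
`C(n, k) C(N - n, m - k) / C(N, m)`. -/
def hypergeometric (m n N : ℕ) : Measure ℤ :=
  ∑ k ∈ Finset.range (m + 1),
    ENNReal.ofReal ((n.choose k : ℝ) * ((N - n).choose (m - k) : ℝ) / (N.choose m : ℝ)) •
      Measure.dirac (k : ℤ)

/-- The mean of a distribution on `ℤ`. -/
def lawMean (ν : Measure ℤ) : ℝ := ∫ k, (k : ℝ) ∂ν

/-- The variance of a distribution on `ℤ`. -/
def lawVar (ν : Measure ℤ) : ℝ := Var[fun k : ℤ => (k : ℝ); ν]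

/-- The translated Poisson distribution `TP(μ, v)`, `v ≥ 0`: with `γ = fract (μ - v)`, it is the law
of `Y` where `Y - μ + v + γ` is `Po(v + γ)`-distributed; note `μ - v - γ = ⌊μ - v⌋`. -/
def translatedPoisson (μ v : ℝ) : Measure ℤ :=
  (poissonMeasure (v + Int.fract (μ - v)).toNNReal).map (fun j : ℕ => (j : ℤ) + ⌊μ - v⌋)

/-- The translated Poisson distribution with the mean of `ν` and variance parameter `Var ν`. -/
def matchingTP (ν : Measure ℤ) : Measure ℤ := translatedPoisson (lawMean ν) (lawVar ν)

/-- Total variation distance `sup_{A ⊆ ℤ} |P(A) - Q(A)|`. -/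
def dTV (P Q : Measure ℤ) : ℝ := ⨆ A : Set ℤ, |P.real A - Q.real A|

/-- Local distance `sup_k |P{k} - Q{k}|`. -/
def dLoc (P Q : Measure ℤ) : ℝ := ⨆ k : ℤ, |P.real {k} - Q.real {k}|

/-- The maximal point probability `max_k P{k}`. -/
def qMax (P : Measure ℤ) : ℝ := ⨆ k : ℤ, P.real {k}

/-- `(W, W')` is an exchangeable pair of integer valued random variables. -/
def IsExchangeablePair {Ω : Type*} [MeasurableSpace Ω] (P : Measure Ω) (W W' : Ω → ℤ) : Prop :=
  Measurable W ∧ Measurable W' ∧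
    P.map (fun ω => (W ω, W' ω)) = P.map (fun ω => (W' ω, W ω))

/-- The linear regression condition `E[W' - μ | W] = (1 - l) (W - μ) + R` (almost surely). -/
def RegressionCondition {Ω : Type*} [MeasurableSpace Ω] (P : Measure Ω) (W W' : Ω → ℤ)
    (μ l : ℝ) (R : Ω → ℝ) : Prop :=
  P[fun ω => (W' ω : ℝ) - μ | MeasurableSpace.comap W inferInstance]
    =ᵐ[P] fun ω => (1 - l) * ((W ω : ℝ) - μ) + R ω

/-- The random variable `S = S(W) = P[W' = W + 1 | W]`. -/
def upProb {Ω : Type*} [MeasurableSpace Ω] (P : Measure Ω) (W W' : Ω → ℤ) : Ω → ℝ :=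
  P[Set.indicator {ω | W' ω = W ω + 1} (fun _ => (1 : ℝ)) |
    MeasurableSpace.comap W inferInstance]

end

/-! This is Stein's method. Let F solve the Poisson Stein equation for a set A, shifted to the
support of TP(μ, v) and extended by 0 below it. Its increments ΔF satisfy |ΔF| ≤ 1/v, and ∑ |ΔF| ≤
2/v when A is a point (`abs_tpSteinDiff_le`, `sum_abs_tpSteinDiff_singleton_le`). Detailed balance
for the chain that moves one ball gives E[(W - μ) F(W)] = E[T ΔF(W)] with T = (m - W)(n - W)/N and E
T = v (`hypProb_stein`, `hypProb_mean_balance`).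

Inserting this into the Stein equation writes P[W ∈ A] - TP(A) as -E[(T - v) ΔF(W)] plus two errors
of size at most 1/v: one from the fractional part in the Poisson rate, one from the mass of W below
the support of TP (Chebyshev). Cauchy–Schwarz on the main term gives both bounds of (i), because S =
λT for the pair of consecutive states of the chain.

The order 1/n of the local distance in (ii) is obtained without estimating q_max. By unimodality |k
- μ| P[W = k] ≤ 1, so P[W = k] |T(k) - v| is bounded, and summing against |ΔF| gives 8/v. -/

/-! ### The Poisson Stein equation and the increments of its solution. -/

/-- The point probabilities of the Poisson distribution satisfy `r p(j) = (j + 1) p(j + 1)`. -/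
lemma poisson_real_singleton_succ (r : NNReal) (j : ℕ) :
    (r : ℝ) * (poissonMeasure r).real {j} = (j + 1) * (poissonMeasure r).real {j + 1} := by
  rw [poissonMeasure_real_singleton, poissonMeasure_real_singleton, Nat.factorial_succ]
  push_cast
  field_simp
  ring

lemma poisson_real_inter_Iio_succ (r : NNReal) (B : Set ℕ) (j : ℕ) :
    (poissonMeasure r).real (B ∩ Set.Iio (j + 1)) = (poissonMeasure r).real (B ∩ Set.Iio j) +
      B.indicator (fun i => (poissonMeasure r).real {i}) j := by
  by_cases h : j ∈ B
  · have : B ∩ Set.Iio (j + 1) = (B ∩ Set.Iio j) ∪ {j} := by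
      ext i
      simp only [Set.mem_inter_iff, Set.mem_Iio, Set.union_singleton, Set.mem_insert_iff]
      constructor
      · rintro ⟨hi, hij⟩
        rcases Nat.lt_succ_iff_lt_or_eq.1 hij with h | h
        · exact Or.inr ⟨hi, h⟩
        · exact Or.inl h
      · rintro (rfl | ⟨hi, hij⟩)
        · exact ⟨h, by lia⟩
        · exact ⟨hi, by lia⟩
    rw [this, measureReal_union (by simp) (by measurability), Set.indicator_of_mem h]
  · have : B ∩ Set.Iio (j + 1) = B ∩ Set.Iio j := by
      ext i
      simp only [Set.mem_inter_iff, Set.mem_Iio, and_congr_right_iff]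
      intro hi
      have : i ≠ j := fun e => h (e ▸ hi)
      lia
    rw [this, Set.indicator_of_notMem h, add_zero]

lemma poisson_real_Iio_succ (r : NNReal) (j : ℕ) :
    (poissonMeasure r).real (Set.Iio (j + 1)) = (poissonMeasure r).real (Set.Iio j) +
      (poissonMeasure r).real {j} := by
  simpa using poisson_real_inter_Iio_succ r Set.univ j

lemma poisson_real_Iio_eq_sum (r : NNReal) (j : ℕ) :
    (poissonMeasure r).real (Set.Iio j) =
      ∑ i ∈ Finset.range j, (poissonMeasure r).real {i} := by
  induction j with
  | zero => simp
  | succ j ih => rw [poisson_real_Iio_succ, ih, Finset.sum_range_succ]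

/-- Termwise, r p(i) = (i + 1) p(i + 1) ≤ j p(i + 1) for i < j. This makes the head ratio monotone.
-/
lemma poisson_head_le (r : NNReal) (j : ℕ) :
    (r : ℝ) * (poissonMeasure r).real (Set.Iio j) ≤
      j * (poissonMeasure r).real (Set.Iio (j + 1)) := by
  induction j with
  | zero => simp
  | succ j ih =>
    have h := poisson_real_singleton_succ r j
    have h1 := poisson_real_Iio_succ r j
    have h2 := poisson_real_Iio_succ r (j + 1)
    have h3 : 0 ≤ (poissonMeasure r).real (Set.Iio (j + 1)) := measureReal_nonneg
    rw [h2]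
    rw [h1] at ih h3 ⊢
    push_cast
    nlinarith

/-- The mirror image: r p(i + j) ≥ j p(i + j + 1) for all i, summed over the tail. -/
lemma poisson_tail_le (r : NNReal) (j : ℕ) :
    (j : ℝ) * (1 - (poissonMeasure r).real (Set.Iio (j + 1))) ≤
      r * (1 - (poissonMeasure r).real (Set.Iio j)) := by
  have hs : HasSum (fun i => (poissonMeasure r).real {i}) 1 := by
    simpa only [poissonMeasure_real_singleton] using hasSum_one_poissonMeasure r
  have h1 := ((hasSum_nat_add_iff' j).2 hs).mul_left (r : ℝ)
  have h2 := ((hasSum_nat_add_iff' (j + 1)).2 hs).mul_left (j : ℝ)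
  rw [poisson_real_Iio_eq_sum, poisson_real_Iio_eq_sum]
  refine hasSum_le (fun i => ?_) h2 h1
  rw [poisson_real_singleton_succ, ← add_assoc]
  have : 0 ≤ (poissonMeasure r).real {i + j + 1} := measureReal_nonneg
  push_cast
  nlinarith [(Nat.cast_nonneg i : (0 : ℝ) ≤ i)]

noncomputable section

/-- `P[X < j] / (j P[X = j])` for `X ∼ Po(r)`. -/
def poissonHeadRatio (r : NNReal) (j : ℕ) : ℝ :=
  (poissonMeasure r).real (Set.Iio j) / (j * (poissonMeasure r).real {j})

/-- `P[X ≥ j] / (j P[X = j])` for `X ∼ Po(r)`. -/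
def poissonTailRatio (r : NNReal) (j : ℕ) : ℝ :=
  (1 - (poissonMeasure r).real (Set.Iio j)) / (j * (poissonMeasure r).real {j})

/-- The solution `f` of the Stein equation `r f(j + 1) - j f(j) = 1_B(j) - Po(r)(B)`
with `f(0) = 0`. -/
def poissonStein (r : NNReal) (B : Set ℕ) (j : ℕ) : ℝ :=
  ((poissonMeasure r).real (B ∩ Set.Iio j) -
    (poissonMeasure r).real B * (poissonMeasure r).real (Set.Iio j)) /
      (j * (poissonMeasure r).real {j})

end

lemma poissonStein_zero (r : NNReal) (B : Set ℕ) : poissonStein r B 0 = 0 := by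
  simp [poissonStein]

/-- In this form the mass of B below j multiplies a decreasing ratio and the mass from j on
multiplies an increasing one with a minus sign. So the solution can only increase through an atom of
B at j. -/
lemma poissonStein_eq (r : NNReal) (B : Set ℕ) (j : ℕ) :
    poissonStein r B j =
      (poissonMeasure r).real (B ∩ Set.Iio j) * poissonTailRatio r j -
      ((poissonMeasure r).real B - (poissonMeasure r).real (B ∩ Set.Iio j)) *
        poissonHeadRatio r j := by
  unfold poissonStein poissonTailRatio poissonHeadRatio
  ring

lemma poisson_real_Iio_le_one (r : NNReal) (j : ℕ) :
    (poissonMeasure r).real (Set.Iio j) ≤ 1 := measureReal_le_one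

lemma poissonHeadRatio_nonneg (r : NNReal) (j : ℕ) : 0 ≤ poissonHeadRatio r j := by
  unfold poissonHeadRatio
  positivity

lemma poissonTailRatio_nonneg (r : NNReal) (j : ℕ) : 0 ≤ poissonTailRatio r j :=
  div_nonneg (sub_nonneg.2 (poisson_real_Iio_le_one r j)) (by positivity)

section

variable {r : NNReal}

lemma poissonStein_equation (hr : 0 < r) (B : Set ℕ) (j : ℕ) :
    r * poissonStein r B (j + 1) - j * poissonStein r B j =
      B.indicator 1 j - (poissonMeasure r).real B := by
  have hp := poissonMeasure_real_singleton_pos j hr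
  have hp' := poissonMeasure_real_singleton_pos (j + 1) hr
  have hs := poisson_real_singleton_succ r j
  have hr' : (0 : ℝ) < r := hr
  have e1 : r * poissonStein r B (j + 1) =
      ((poissonMeasure r).real (B ∩ Set.Iio (j + 1)) -
        (poissonMeasure r).real B * (poissonMeasure r).real (Set.Iio (j + 1))) /
          (poissonMeasure r).real {j} := by
    unfold poissonStein
    push_cast
    rw [← hs]
    field_simp
  have e2 : j * poissonStein r B j =
      ((poissonMeasure r).real (B ∩ Set.Iio j) -
        (poissonMeasure r).real B * (poissonMeasure r).real (Set.Iio j)) /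
          (poissonMeasure r).real {j} := by
    unfold poissonStein
    rcases Nat.eq_zero_or_pos j with rfl | hj
    · simp
    · field_simp
  have e3 : B.indicator (fun i => (poissonMeasure r).real {i}) j =
      B.indicator 1 j * (poissonMeasure r).real {j} := by
    by_cases h : j ∈ B <;> simp [h]
  rw [e1, e2, poisson_real_inter_Iio_succ, poisson_real_Iio_succ, e3]
  field_simp
  ring

lemma poissonHeadRatio_mono (hr : 0 < r) (j : ℕ) :
    poissonHeadRatio r j ≤ poissonHeadRatio r (j + 1) := by
  rcases Nat.eq_zero_or_pos j with rfl | hj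
  · simpa [poissonHeadRatio] using poissonHeadRatio_nonneg r 1
  · have hp := poissonMeasure_real_singleton_pos j hr
    have hr' : (0 : ℝ) < r := hr
    have hj' : (0 : ℝ) < j := by exact_mod_cast hj
    unfold poissonHeadRatio
    push_cast
    rw [← poisson_real_singleton_succ, div_le_div_iff₀ (by positivity) (by positivity)]
    nlinarith [poisson_head_le r j]

/-- At j = 0 this fails: division by zero makes the ratio 0 there. -/
lemma poissonTailRatio_anti (hr : 0 < r) {j : ℕ} (hj : 0 < j) :
    poissonTailRatio r (j + 1) ≤ poissonTailRatio r j := by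
  have hp := poissonMeasure_real_singleton_pos j hr
  have hr' : (0 : ℝ) < r := hr
  have hj' : (0 : ℝ) < j := by exact_mod_cast hj
  unfold poissonTailRatio
  push_cast
  rw [← poisson_real_singleton_succ, div_le_div_iff₀ (by positivity) (by positivity)]
  nlinarith [poisson_tail_le r j]

/-- The first product equals P[X > j]/r, the second is at most P[X ≤ j]/r. This bounds the upward
jump caused by an atom at j. -/
lemma poisson_spike_le (hr : 0 < r) (j : ℕ) :
    (poissonMeasure r).real {j} * (poissonTailRatio r (j + 1) + poissonHeadRatio r j) ≤ 1 / r := by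
  have hp := poissonMeasure_real_singleton_pos j hr
  have hr' : (0 : ℝ) < r := hr
  have e1 : (poissonMeasure r).real {j} * poissonTailRatio r (j + 1) =
      (1 - (poissonMeasure r).real (Set.Iio (j + 1))) / r := by
    unfold poissonTailRatio
    push_cast
    rw [← poisson_real_singleton_succ]
    field_simp
  have e2 : (poissonMeasure r).real {j} * poissonHeadRatio r j ≤
      (poissonMeasure r).real (Set.Iio (j + 1)) / r := by
    unfold poissonHeadRatio
    rcases Nat.eq_zero_or_pos j with rfl | hj
    · simp only [CharP.cast_eq_zero, zero_mul, div_zero, mul_zero]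
      positivity
    · have hj' : (0 : ℝ) < j := by exact_mod_cast hj
      rw [le_div_iff₀ hr', ← mul_div_assoc, div_mul_eq_mul_div, div_le_iff₀ (by positivity)]
      nlinarith [poisson_head_le r j]
  rw [mul_add, e1]
  calc _ ≤ _ := add_le_add_right e2 _
    _ = 1 / r := by ring

lemma poissonStein_succ_sub_le (hr : 0 < r) (B : Set ℕ) (j : ℕ) :
    poissonStein r B (j + 1) - poissonStein r B j ≤ 1 / r := by
  rw [poissonStein_eq, poissonStein_eq]
  have hs := poisson_real_inter_Iio_succ r B j
  have ha : 0 ≤ (poissonMeasure r).real (B ∩ Set.Iio j) := measureReal_nonneg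
  have hb : (poissonMeasure r).real (B ∩ Set.Iio (j + 1)) ≤ (poissonMeasure r).real B :=
    measureReal_mono Set.inter_subset_left
  have hi : B.indicator (fun i => (poissonMeasure r).real {i}) j ≤ (poissonMeasure r).real {j} :=
    Set.indicator_le_self' (fun _ _ => measureReal_nonneg) j
  have hspike := poisson_spike_le hr j
  have h1 : (poissonMeasure r).real (B ∩ Set.Iio j) *
      (poissonTailRatio r (j + 1) - poissonTailRatio r j) ≤ 0 := by
    rcases Nat.eq_zero_or_pos j with rfl | hj
    · simp
    · exact mul_nonpos_of_nonneg_of_nonpos ha (sub_nonpos.2 (poissonTailRatio_anti hr hj))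
  have h2 : 0 ≤ ((poissonMeasure r).real B - (poissonMeasure r).real (B ∩ Set.Iio (j + 1))) *
      (poissonHeadRatio r (j + 1) - poissonHeadRatio r j) :=
    mul_nonneg (sub_nonneg.2 hb) (sub_nonneg.2 (poissonHeadRatio_mono hr j))
  have h3 := mul_le_mul_of_nonneg_right hi
    (add_nonneg (poissonTailRatio_nonneg r (j + 1)) (poissonHeadRatio_nonneg r j))
  generalize B.indicator (fun i => (poissonMeasure r).real {i}) j = β at *
  rw [hs] at h2 ⊢
  linarith

/-- Turns the one-sided increment bound into a two-sided one. -/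
lemma poissonStein_compl (B : Set ℕ) (j : ℕ) : poissonStein r Bᶜ j = -poissonStein r B j := by
  have h1 : (poissonMeasure r).real Bᶜ = 1 - (poissonMeasure r).real B :=
    probReal_compl_eq_one_sub (by measurability)
  have h2 : (poissonMeasure r).real (Set.Iio j) =
      (poissonMeasure r).real (B ∩ Set.Iio j) + (poissonMeasure r).real (Bᶜ ∩ Set.Iio j) := by
    rw [Set.inter_comm, Set.inter_comm Bᶜ, ← Set.sdiff_eq]
    exact (measureReal_inter_add_sdiff (by measurability)).symm
  unfold poissonStein
  rw [h1, h2]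
  ring

lemma abs_poissonStein_succ_sub_le (hr : 0 < r) (B : Set ℕ) (j : ℕ) :
    |poissonStein r B (j + 1) - poissonStein r B j| ≤ 1 / r := by
  have h1 := poissonStein_succ_sub_le hr B j
  have h2 := poissonStein_succ_sub_le hr Bᶜ j
  rw [poissonStein_compl, poissonStein_compl] at h2
  exact abs_le.2 ⟨by linarith, h1⟩

lemma poissonStein_singleton_of_le {t j : ℕ} (h : j ≤ t) :
    poissonStein r {t} j = -((poissonMeasure r).real {t} * poissonHeadRatio r j) := by
  have : ({t} : Set ℕ) ∩ Set.Iio j = ∅ := by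
    ext i
    simp only [Set.mem_inter_iff, Set.mem_singleton_iff, Set.mem_Iio, Set.mem_empty_iff_false]
    lia
  rw [poissonStein_eq, this]
  simp

lemma poissonStein_singleton_of_lt {t j : ℕ} (h : t < j) :
    poissonStein r {t} j = (poissonMeasure r).real {t} * poissonTailRatio r j := by
  have : ({t} : Set ℕ) ∩ Set.Iio j = {t} := by
    ext i
    simp only [Set.mem_inter_iff, Set.mem_singleton_iff, Set.mem_Iio]
    lia
  rw [poissonStein_eq, this]
  simp

/-- Apart from an upward jump at `t`, the solution for the set `{t}` is nonincreasing. -/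
lemma poissonStein_singleton_succ_le (hr : 0 < r) {t j : ℕ} (h : j ≠ t) :
    poissonStein r {t} (j + 1) ≤ poissonStein r {t} j := by
  have hp : 0 ≤ (poissonMeasure r).real {t} := measureReal_nonneg
  rcases lt_or_gt_of_ne h with h | h
  · rw [poissonStein_singleton_of_le h, poissonStein_singleton_of_le h.le]
    exact neg_le_neg (mul_le_mul_of_nonneg_left (poissonHeadRatio_mono hr j) hp)
  · rw [poissonStein_singleton_of_lt h, poissonStein_singleton_of_lt (by lia)]
    exact mul_le_mul_of_nonneg_left (poissonTailRatio_anti hr (by lia)) hp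

lemma sum_range_abs_poissonStein_singleton_le (hr : 0 < r) (t n : ℕ) :
    ∑ j ∈ Finset.range n, |poissonStein r {t} (j + 1) - poissonStein r {t} j| ≤ 2 / r := by
  set f := poissonStein r {t} with hf
  have h0 : f 0 = 0 := poissonStein_zero _ _
  have ht := abs_poissonStein_succ_sub_le hr {t} t
  -- Since f(0) = 0 and f decreases except at t, the sum telescopes on either side of the jump.
  have hsum : ∀ n, ∑ j ∈ Finset.range n, |f (j + 1) - f j| =
      if n ≤ t then -f n else
        |f (t + 1) - f t| + (f (t + 1) - f t) - f n := by
    intro n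
    induction n with
    | zero => simp [h0]
    | succ n ih =>
      rw [Finset.sum_range_succ, ih]
      rcases lt_trichotomy n t with h | rfl | h
      · rw [if_pos h.le, if_pos (Nat.succ_le_of_lt h),
          abs_of_nonpos (sub_nonpos.2 (poissonStein_singleton_succ_le hr h.ne))]
        ring
      · rw [if_pos le_rfl, if_neg (by lia)]
        ring
      · rw [if_neg (by lia), if_neg (by lia),
          abs_of_nonpos (sub_nonpos.2 (poissonStein_singleton_succ_le hr h.ne'))]
        ring
  -- The range is extended past t, where f ≥ 0 and the closed form is at most twice the jump.
  have hn : ∑ j ∈ Finset.range n, |f (j + 1) - f j| ≤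
      ∑ j ∈ Finset.range (n + t + 1), |f (j + 1) - f j| :=
    Finset.sum_le_sum_of_subset_of_nonneg (Finset.range_subset_range.2 (by lia))
      (fun _ _ _ => abs_nonneg _)
  have hfn : 0 ≤ f (n + t + 1) := by
    rw [hf, poissonStein_singleton_of_lt (by lia)]
    exact mul_nonneg measureReal_nonneg (poissonTailRatio_nonneg _ _)
  rw [hsum (n + t + 1), if_neg (by lia)] at hn
  have := le_abs_self (f (t + 1) - f t)
  have e : (2 : ℝ) / r = 1 / r + 1 / r := by ring
  rw [e]
  linarith

end

/-! ### Hypergeometric point probabilities: reversibility, moments, unimodality. -/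

noncomputable section

/-- The point probability of `Hyp(m, n, N)` at `k ≤ m`. -/
def hypProb (m n N k : ℕ) : ℝ :=
  (n.choose k : ℝ) * ((N - n).choose (m - k) : ℝ) / (N.choose m : ℝ)

end

section

variable {m n N : ℕ}

lemma hypProb_nonneg (m n N k : ℕ) : 0 ≤ hypProb m n N k := by
  unfold hypProb
  positivity

lemma sum_hypProb (hm : m ≤ N) (hn : n ≤ N) :
    ∑ k ∈ Finset.range (m + 1), hypProb m n N k = 1 := by
  have h := Nat.add_choose_eq n (N - n) m
  rw [Nat.add_sub_cancel' hn, Finset.Nat.sum_antidiagonal_eq_sum_range_succ_mk] at h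
  have hpos : (0 : ℝ) < (N.choose m : ℝ) := by exact_mod_cast Nat.choose_pos hm
  simp only [hypProb]
  rw [← Finset.sum_div, div_eq_one_iff_eq hpos.ne', h]
  push_cast
  rfl

lemma le_of_hypProb_ne_zero {k : ℕ} (h : hypProb m n N k ≠ 0) : k ≤ n ∧ m - k ≤ N - n := by
  constructor <;> by_contra! h' <;> apply h <;> unfold hypProb
  · rw [Nat.choose_eq_zero_of_lt h']; simp
  · rw [Nat.choose_eq_zero_of_lt h']; simp

/-- The hypergeometric distribution is reversible for the chain which moves one ball. -/
lemma hypProb_balance (hn : n ≤ N) {k : ℕ} (hk : k < m) :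
    hypProb m n N k * ((m - k) * (n - k)) =
      hypProb m n N (k + 1) * ((k + 1) * ((N : ℝ) - n - m + k + 1)) := by
  obtain ⟨l, rfl⟩ : ∃ l, m = k + 1 + l := ⟨m - k - 1, by lia⟩
  have h1 : (n.choose (k + 1) : ℝ) * (k + 1) = n.choose k * (n - k) := by
    have h := Nat.choose_succ_right_eq n k
    rcases le_or_gt k n with hkn | hkn
    · have h' := congrArg (Nat.cast : ℕ → ℝ) h
      push_cast [hkn] at h'
      exact h'
    · rw [Nat.choose_eq_zero_of_lt hkn, Nat.choose_eq_zero_of_lt (by lia)]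
      simp
  have h2 : ((N - n).choose (l + 1) : ℝ) * (l + 1) = (N - n).choose l * ((N : ℝ) - n - l) := by
    have h := Nat.choose_succ_right_eq (N - n) l
    rcases le_or_gt l (N - n) with hl | hl
    · have h' := congrArg (Nat.cast : ℕ → ℝ) h
      push_cast [hl, hn] at h'
      exact h'
    · rw [Nat.choose_eq_zero_of_lt hl, Nat.choose_eq_zero_of_lt (by lia)]
      simp
  unfold hypProb
  have e1 : k + 1 + l - k = l + 1 := by lia
  have e2 : k + 1 + l - (k + 1) = l := by lia
  rw [e1, e2, div_mul_eq_mul_div, div_mul_eq_mul_div]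
  congr 1
  push_cast
  linear_combination (n.choose k : ℝ) * (n - k) * h2 - (N - n).choose l * ((N : ℝ) - n - l) * h1

/-- An index shift in detailed balance; the boundary terms vanish through the factors m - k at k = m
and k at k = 0. -/
lemma sum_hypProb_balance (hn : n ≤ N) (f : ℕ → ℝ) :
    ∑ k ∈ Finset.range (m + 1), hypProb m n N k * (((m : ℝ) - k) * (n - k) * f (k + 1)) =
      ∑ k ∈ Finset.range (m + 1), hypProb m n N k * (k * ((N : ℝ) - n - m + k) * f k) := by
  rw [Finset.sum_range_succ, Finset.sum_range_succ' _ m]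
  simp only [sub_self, zero_mul, mul_zero, add_zero, CharP.cast_eq_zero]
  refine Finset.sum_congr rfl fun k hk => ?_
  rw [← mul_assoc, hypProb_balance hn (Finset.mem_range.1 hk)]
  push_cast
  ring

/-- The discrete Stein identity of the hypergeometric distribution. -/
lemma hypProb_stein (hn : n ≤ N) (f : ℕ → ℝ) :
    ∑ k ∈ Finset.range (m + 1), hypProb m n N k * (((N : ℝ) * k - m * n) * f k) =
      ∑ k ∈ Finset.range (m + 1),
        hypProb m n N k * (((m : ℝ) - k) * (n - k) * (f (k + 1) - f k)) := by
  have e : ∑ k ∈ Finset.range (m + 1),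
      hypProb m n N k * (((m : ℝ) - k) * (n - k) * (f (k + 1) - f k)) =
      ∑ k ∈ Finset.range (m + 1), hypProb m n N k * (((m : ℝ) - k) * (n - k) * f (k + 1)) -
        ∑ k ∈ Finset.range (m + 1), hypProb m n N k * (((m : ℝ) - k) * (n - k) * f k) := by
    rw [← Finset.sum_sub_distrib]
    exact Finset.sum_congr rfl fun k _ => by ring
  -- What remains is k(N - n - m + k) - (m - k)(n - k) = Nk - mn.
  rw [e, sum_hypProb_balance hn, ← Finset.sum_sub_distrib]
  exact Finset.sum_congr rfl fun k _ => by ring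

lemma hypProb_mean (hm : m ≤ N) (hn : n ≤ N) (hN : 0 < N) :
    ∑ k ∈ Finset.range (m + 1), hypProb m n N k * k = (m : ℝ) * n / N := by
  have h := hypProb_stein (m := m) hn (fun _ => 1)
  have hN' : (N : ℝ) ≠ 0 := by exact_mod_cast hN.ne'
  simp only [mul_one, sub_self, mul_zero, Finset.sum_const_zero, mul_sub,
    Finset.sum_sub_distrib] at h
  rw [← Finset.sum_mul, sum_hypProb hm hn, one_mul, sub_eq_zero] at h
  rw [eq_div_iff hN', ← h, Finset.sum_mul]
  exact Finset.sum_congr rfl fun k _ => by ring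

/-- The Stein identity with f(k) = k; the square from (m - k)(n - k) moves to the left, which turns
N into N - 1. -/
lemma hypProb_second_moment (hm : m ≤ N) (hn : n ≤ N) (hN : 0 < N) :
    ((N : ℝ) - 1) * ∑ k ∈ Finset.range (m + 1), hypProb m n N k * (k : ℝ) ^ 2 =
      m * n + (m * n - (m + n)) * (m * n / N) := by
  have h := hypProb_stein (m := m) hn (fun k => (k : ℝ))
  have h1 := hypProb_mean hm hn hN
  have h0 := sum_hypProb hm hn
  have e1 : ∑ k ∈ Finset.range (m + 1), hypProb m n N k * (((N : ℝ) * k - m * n) * k) =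
      N * ∑ k ∈ Finset.range (m + 1), hypProb m n N k * (k : ℝ) ^ 2 -
        m * n * ∑ k ∈ Finset.range (m + 1), hypProb m n N k * k := by
    rw [Finset.mul_sum, Finset.mul_sum, ← Finset.sum_sub_distrib]
    exact Finset.sum_congr rfl fun k _ => by ring
  have e2 : ∑ k ∈ Finset.range (m + 1),
      hypProb m n N k * (((m : ℝ) - k) * (n - k) * (((k + 1 : ℕ) : ℝ) - k)) =
      m * n * ∑ k ∈ Finset.range (m + 1), hypProb m n N k -
        (m + n) * ∑ k ∈ Finset.range (m + 1), hypProb m n N k * k +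
          ∑ k ∈ Finset.range (m + 1), hypProb m n N k * (k : ℝ) ^ 2 := by
    rw [Finset.mul_sum, Finset.mul_sum, ← Finset.sum_sub_distrib, ← Finset.sum_add_distrib]
    refine Finset.sum_congr rfl fun k _ => ?_
    push_cast
    ring
  rw [e1, e2, h0, h1] at h
  linarith

lemma hypProb_variance (hm : m ≤ N) (hn : n ≤ N) (hN : 2 ≤ N) :
    ∑ k ∈ Finset.range (m + 1), hypProb m n N k * ((k : ℝ) - m * n / N) ^ 2 =
      (n : ℝ) * m * ((N : ℝ) - n) * ((N : ℝ) - m) / (((N : ℝ) - 1) * (N : ℝ) ^ 2) := by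
  have h2 := hypProb_second_moment hm hn (by lia)
  have h1 := hypProb_mean hm hn (by lia)
  have h0 := sum_hypProb hm hn
  have hN' : (2 : ℝ) ≤ N := by exact_mod_cast hN
  have hN1 : (N : ℝ) - 1 ≠ 0 := by linarith
  have hN0 : (N : ℝ) ≠ 0 := by linarith
  have e : ∑ k ∈ Finset.range (m + 1), hypProb m n N k * ((k : ℝ) - m * n / N) ^ 2 =
      ∑ k ∈ Finset.range (m + 1), hypProb m n N k * (k : ℝ) ^ 2 -
        2 * (m * n / N) * ∑ k ∈ Finset.range (m + 1), hypProb m n N k * k +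
          (m * n / N) ^ 2 * ∑ k ∈ Finset.range (m + 1), hypProb m n N k := by
    rw [Finset.mul_sum, Finset.mul_sum, ← Finset.sum_sub_distrib, ← Finset.sum_add_distrib]
    exact Finset.sum_congr rfl fun k _ => by ring
  rw [e, h1, h0, eq_div_iff (by positivity)]
  field_simp at h2 ⊢
  linear_combination N * h2

/-- The Stein identity with f(k) = k - μ, whose increments are 1. Hence E T = Var W, so E (T - v)²
is the variance of T. -/
lemma hypProb_mean_balance (hn : n ≤ N) (hN : 0 < N) :
    ∑ k ∈ Finset.range (m + 1), hypProb m n N k * (((m : ℝ) - k) * (n - k) / N) =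
      ∑ k ∈ Finset.range (m + 1), hypProb m n N k * ((k : ℝ) - m * n / N) ^ 2 := by
  have hN' : (N : ℝ) ≠ 0 := by exact_mod_cast hN.ne'
  have h := hypProb_stein (m := m) hn (fun k => (k : ℝ) - m * n / N)
  have e : ∀ k : ℕ, ((k + 1 : ℕ) : ℝ) - m * n / N - (k - m * n / N) = 1 := fun k => by
    push_cast
    ring
  simp only [e, mul_one] at h
  have e1 : ∑ k ∈ Finset.range (m + 1), hypProb m n N k * (((m : ℝ) - k) * (n - k) / N) =
      (∑ k ∈ Finset.range (m + 1), hypProb m n N k * (((m : ℝ) - k) * (n - k))) / N := by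
    rw [Finset.sum_div]
    exact Finset.sum_congr rfl fun k _ => by ring
  rw [e1, ← h, Finset.sum_div]
  refine Finset.sum_congr rfl fun k _ => ?_
  field_simp

/-- By detailed balance it suffices to compare the weights of the moves between k and k + 1. Down
minus up is (Nk - mn) + (N - n - m + 2k) + 1. -/
lemma hypProb_succ_le (hm : m ≤ N) (hn : n ≤ N) {k : ℕ} (hk : k < m) (hμ : m * n ≤ N * k) :
    hypProb m n N (k + 1) ≤ hypProb m n N k := by
  rcases (hypProb_nonneg m n N (k + 1)).eq_or_lt' with h0 | h0
  · rw [h0]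
    exact hypProb_nonneg _ _ _ _
  · have hkn := (le_of_hypProb_ne_zero h0.ne').1
    have hb := hypProb_balance hn hk
    have c1 : (k : ℝ) < m := by exact_mod_cast hk
    have c2 : (k : ℝ) + 1 ≤ n := by exact_mod_cast hkn
    have c3 : (m : ℝ) ≤ N := by exact_mod_cast hm
    have c4 : (n : ℝ) ≤ N := by exact_mod_cast hn
    have c5 : (m : ℝ) * n ≤ N * k := by exact_mod_cast hμ
    have c6 : (0 : ℝ) ≤ k := Nat.cast_nonneg k
    -- Multiplied by N, this is at least (N - m)(N - n) + mn.
    have c7 : (0 : ℝ) ≤ (N : ℝ) - n - m + 2 * k := by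
      have : 0 ≤ (N : ℝ) * ((N : ℝ) - n - m + 2 * k) := by
        nlinarith [mul_nonneg (sub_nonneg.2 c3) (sub_nonneg.2 c4),
          (by positivity : (0 : ℝ) ≤ (m : ℝ) * n)]
      exact nonneg_of_mul_nonneg_right this (by linarith)
    have hA : (0 : ℝ) < ((m : ℝ) - k) * (n - k) := mul_pos (by linarith) (by linarith)
    have hAD : ((m : ℝ) - k) * (n - k) ≤ (k + 1) * ((N : ℝ) - n - m + k + 1) := by nlinarith
    refine le_of_mul_le_mul_right ?_ (hA.trans_le hAD)
    rw [← hb]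
    exact mul_le_mul_of_nonneg_left hAD (hypProb_nonneg _ _ _ _)

lemma hypProb_le_succ (hm : m ≤ N) (hn : n ≤ N) (hN : 0 < N) {k : ℕ}
    (hμ : N * (k + 1) ≤ m * n) : hypProb m n N k ≤ hypProb m n N (k + 1) := by
  have hkm : k < m := by
    by_contra! h
    have := Nat.mul_le_mul h hn
    nlinarith
  have hkn : k < n := by
    by_contra! h
    have := Nat.mul_le_mul hm h
    nlinarith
  have hb := hypProb_balance hn hkm
  have c1 : (k : ℝ) + 1 ≤ m := by exact_mod_cast hkm
  have c2 : (k : ℝ) + 1 ≤ n := by exact_mod_cast hkn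
  have c5 : (N : ℝ) * (k + 1) ≤ m * n := by exact_mod_cast hμ
  have hA : (0 : ℝ) < ((m : ℝ) - k) * (n - k) := mul_pos (by linarith) (by linarith)
  have hAD : (k + 1) * ((N : ℝ) - n - m + k + 1) ≤ ((m : ℝ) - k) * (n - k) := by nlinarith
  refine le_of_mul_le_mul_right ?_ hA
  rw [hb]
  exact mul_le_mul_of_nonneg_left hAD (hypProb_nonneg _ _ _ _)

/-- If `q` is at least `q k` on `[a, b] ⊆ [0, m]`, then `(b - a + 1) q k ≤ 1`. -/
lemma hypProb_card_mul_le (hm : m ≤ N) (hn : n ≤ N) {a b k : ℕ} (hb : b ≤ m) (hab : a ≤ b)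
    (h : ∀ i ∈ Finset.Icc a b, hypProb m n N k ≤ hypProb m n N i) :
    ((b : ℝ) + 1 - a) * hypProb m n N k ≤ 1 := by
  have h1 := Finset.card_nsmul_le_sum _ _ _ h
  have h2 : ∑ i ∈ Finset.Icc a b, hypProb m n N i ≤
      ∑ i ∈ Finset.range (m + 1), hypProb m n N i := by
    refine Finset.sum_le_sum_of_subset_of_nonneg (fun i hi => ?_)
      (fun _ _ _ => hypProb_nonneg _ _ _ _)
    rw [Finset.mem_Icc] at hi
    exact Finset.mem_range.2 (by lia)
  rw [sum_hypProb hm hn] at h2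
  rw [Nat.card_Icc, nsmul_eq_mul, Nat.cast_sub (by lia)] at h1
  push_cast at h1
  exact h1.trans h2

/-- By unimodality every integer between the mean and k has probability at least that of k, and
there are at least |k - μ| of them. -/
lemma abs_sub_mean_mul_hypProb_le (hm : m ≤ N) (hn : n ≤ N) (hN : 0 < N) {k : ℕ} (hk : k ≤ m) :
    |(k : ℝ) - m * n / N| * hypProb m n N k ≤ 1 := by
  have hN' : (0 : ℝ) < N := by exact_mod_cast hN
  have hμ0 : (0 : ℝ) ≤ (m : ℝ) * n / N := by positivity
  have hq := hypProb_nonneg m n N k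
  rcases le_total ((m : ℝ) * n / N) k with h | h
  · have hck : ⌈(m : ℝ) * n / N⌉₊ ≤ k := Nat.ceil_le.2 h
    have h1 := hypProb_card_mul_le (k := k) hm hn hk hck (fun i hi => by
      rw [Finset.mem_Icc, Nat.ceil_le, div_le_iff₀' hN'] at hi
      obtain ⟨hi1, hi2⟩ := hi
      have hi1' : m * n ≤ N * i := by exact_mod_cast hi1
      clear h hck hi1 hq
      induction k, hi2 using Nat.le_induction with
      | base => exact le_rfl
      | succ j hj ih =>
        exact (hypProb_succ_le hm hn (by lia) (hi1'.trans (Nat.mul_le_mul_left N hj))).trans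
          (ih (by lia)))
    rw [abs_of_nonneg (sub_nonneg.2 h)]
    refine le_trans (mul_le_mul_of_nonneg_right ?_ hq) h1
    linarith [Nat.ceil_lt_add_one hμ0]
  · have hck : k ≤ ⌊(m : ℝ) * n / N⌋₊ := Nat.le_floor h
    have hcm : ⌊(m : ℝ) * n / N⌋₊ ≤ m := by
      refine Nat.floor_le_of_le ?_
      rw [div_le_iff₀ hN']
      have : (n : ℝ) ≤ N := by exact_mod_cast hn
      gcongr
    have h1 := hypProb_card_mul_le (k := k) hm hn hcm hck (fun i hi => by
      rw [Finset.mem_Icc, Nat.le_floor_iff hμ0, le_div_iff₀' hN'] at hi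
      obtain ⟨hi1, hi2⟩ := hi
      have hi2' : N * i ≤ m * n := by exact_mod_cast hi2
      clear hi2
      induction i, hi1 using Nat.le_induction with
      | base => exact le_rfl
      | succ j hj ih =>
        exact (ih (by nlinarith)).trans (hypProb_le_succ hm hn hN hi2'))
    rw [abs_of_nonpos (sub_nonpos.2 h)]
    refine le_trans (mul_le_mul_of_nonneg_right ?_ hq) h1
    linarith [Nat.lt_floor_add_one ((m : ℝ) * n / N)]

/-! ### The hypergeometric law as a measure. -/

lemma hypergeometric_eq (m n N : ℕ) : hypergeometric m n N =
    ∑ k ∈ Finset.range (m + 1), ENNReal.ofReal (hypProb m n N k) • Measure.dirac (k : ℤ) := rfl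

lemma integral_sum_smul_dirac {α : Type*} [MeasurableSpace α] [MeasurableSingletonClass α]
    {ι : Type*} (s : Finset ι) (c : ι → ℝ) (hc : ∀ i ∈ s, 0 ≤ c i) (x : ι → α) (f : α → ℝ) :
    ∫ a, f a ∂(∑ i ∈ s, ENNReal.ofReal (c i) • Measure.dirac (x i)) = ∑ i ∈ s, c i * f (x i) := by
  rw [integral_finsetSum_measure]
  · refine Finset.sum_congr rfl fun i hi => ?_
    rw [integral_smul_measure, integral_dirac, ENNReal.toReal_ofReal (hc i hi), smul_eq_mul]
  · intro i _
    exact (integrable_dirac (by simp)).smul_measure ENNReal.ofReal_ne_top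

lemma integral_hypergeometric (m n N : ℕ) (f : ℤ → ℝ) :
    ∫ a, f a ∂(hypergeometric m n N) =
      ∑ k ∈ Finset.range (m + 1), hypProb m n N k * f k :=
  integral_sum_smul_dirac _ _ (fun _ _ => hypProb_nonneg _ _ _ _) _ f

lemma isProbabilityMeasure_hypergeometric (hm : m ≤ N) (hn : n ≤ N) :
    IsProbabilityMeasure (hypergeometric m n N) := by
  constructor
  rw [hypergeometric_eq]
  simp only [Measure.coe_finsetSum, Measure.coe_smul, Finset.sum_apply, Pi.smul_apply,
    measure_univ, smul_eq_mul, mul_one]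
  rw [← ENNReal.ofReal_sum_of_nonneg (fun _ _ => hypProb_nonneg _ _ _ _), sum_hypProb hm hn,
    ENNReal.ofReal_one]

lemma hypergeometric_real_apply (m n N : ℕ) (A : Set ℤ) :
    (hypergeometric m n N).real A =
      ∑ k ∈ Finset.range (m + 1), hypProb m n N k * A.indicator 1 (k : ℤ) := by
  rw [← integral_hypergeometric, integral_indicator_one (by measurability)]

lemma lawMean_hypergeometric (hm : m ≤ N) (hn : n ≤ N) (hN : 0 < N) :
    lawMean (hypergeometric m n N) = (m : ℝ) * n / N := by
  rw [lawMean, integral_hypergeometric, ← hypProb_mean hm hn hN]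
  simp

lemma variance_hypergeometric (m n N : ℕ) (f : ℤ → ℝ) :
    Var[f; hypergeometric m n N] = ∑ k ∈ Finset.range (m + 1), hypProb m n N k *
      (f k - ∑ k ∈ Finset.range (m + 1), hypProb m n N k * f k) ^ 2 := by
  rw [variance_eq_integral (Measurable.of_discrete).aemeasurable, integral_hypergeometric,
    integral_hypergeometric]

lemma lawVar_hypergeometric (hm : m ≤ N) (hn : n ≤ N) (hN : 0 < N) :
    lawVar (hypergeometric m n N) =
      ∑ k ∈ Finset.range (m + 1), hypProb m n N k * ((k : ℝ) - m * n / N) ^ 2 := by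
  rw [lawVar, variance_hypergeometric, ← hypProb_mean hm hn hN]
  simp

end

/-! ### The Stein equation of the translated Poisson distribution. -/

noncomputable section

/-- The rate of the Poisson distribution underlying `TP(μ, v)`. -/
def tpRate (μ v : ℝ) : NNReal := (v + Int.fract (μ - v)).toNNReal

/-- The increment at `k` of the Poisson Stein solution for `TP(μ, v)` and the set `A`. -/
def tpSteinDiff (μ v : ℝ) (A : Set ℤ) (k : ℤ) : ℝ :=
  poissonStein (tpRate μ v) ((fun j : ℕ => (j : ℤ) + ⌊μ - v⌋) ⁻¹' A) (k + 1 - ⌊μ - v⌋).toNat -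
    poissonStein (tpRate μ v) ((fun j : ℕ => (j : ℤ) + ⌊μ - v⌋) ⁻¹' A) (k - ⌊μ - v⌋).toNat

end

section

variable {μ v : ℝ}

lemma coe_tpRate (hv : 0 < v) : (tpRate μ v : ℝ) = v + Int.fract (μ - v) :=
  Real.coe_toNNReal _ (add_nonneg hv.le (Int.fract_nonneg _))

lemma tpRate_pos (hv : 0 < v) : 0 < tpRate μ v :=
  Real.toNNReal_pos.2 (add_pos_of_pos_of_nonneg hv (Int.fract_nonneg _))

lemma le_tpRate (hv : 0 < v) : v ≤ tpRate μ v := by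
  rw [coe_tpRate hv]
  linarith [Int.fract_nonneg (μ - v)]

lemma translatedPoisson_real_apply (μ v : ℝ) (A : Set ℤ) :
    (translatedPoisson μ v).real A =
      (poissonMeasure (tpRate μ v)).real ((fun j : ℕ => (j : ℤ) + ⌊μ - v⌋) ⁻¹' A) := by
  rw [translatedPoisson, map_measureReal_apply (Measurable.of_discrete) (by measurability)]
  rfl

lemma isProbabilityMeasure_translatedPoisson (μ v : ℝ) :
    IsProbabilityMeasure (translatedPoisson μ v) :=
  Measure.isProbabilityMeasure_map (Measurable.of_discrete).aemeasurable

/-- `toNat` sends both arguments to 0, also for k = ⌊μ - v⌋ - 1. -/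
lemma tpSteinDiff_of_lt {A : Set ℤ} {k : ℤ} (h : k < ⌊μ - v⌋) : tpSteinDiff μ v A k = 0 := by
  rw [tpSteinDiff, Int.toNat_of_nonpos (by lia), Int.toNat_of_nonpos (by lia), sub_self]

lemma tpSteinDiff_of_le {A : Set ℤ} {k : ℤ} {j : ℕ} (h : k = j + ⌊μ - v⌋) :
    tpSteinDiff μ v A k =
      poissonStein (tpRate μ v) ((fun j : ℕ => (j : ℤ) + ⌊μ - v⌋) ⁻¹' A) (j + 1) -
        poissonStein (tpRate μ v) ((fun j : ℕ => (j : ℤ) + ⌊μ - v⌋) ⁻¹' A) j := by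
  subst h
  rw [tpSteinDiff]
  congr 2 <;> lia

lemma abs_tpSteinDiff_le (hv : 0 < v) (A : Set ℤ) (k : ℤ) : |tpSteinDiff μ v A k| ≤ 1 / v := by
  rcases lt_or_ge k ⌊μ - v⌋ with h | h
  · rw [tpSteinDiff_of_lt h, abs_zero]
    positivity
  · obtain ⟨j, hj⟩ := Int.eq_ofNat_of_zero_le (sub_nonneg.2 h)
    rw [tpSteinDiff_of_le (j := j) (by lia)]
    exact (abs_poissonStein_succ_sub_le (tpRate_pos hv) _ _).trans
      (one_div_le_one_div_of_le hv (le_tpRate hv))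

lemma sum_abs_tpSteinDiff_singleton_le (hv : 0 < v) (t : ℤ) (M : ℕ) :
    ∑ k ∈ Finset.range M, |tpSteinDiff μ v {t} k| ≤ 2 / v := by
  rcases lt_or_ge t ⌊μ - v⌋ with h | h
  · have he : (fun j : ℕ => (j : ℤ) + ⌊μ - v⌋) ⁻¹' {t} = ∅ := by
      ext j
      simp only [Set.mem_preimage, Set.mem_singleton_iff, Set.mem_empty_iff_false]
      lia
    have hz : ∀ k, tpSteinDiff μ v {t} k = 0 := fun k => by
      rw [tpSteinDiff, he]
      simp [poissonStein]
    simp only [hz, abs_zero, Finset.sum_const_zero]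
    positivity
  · obtain ⟨u, hu⟩ := Int.eq_ofNat_of_zero_le (sub_nonneg.2 h)
    have he : (fun j : ℕ => (j : ℤ) + ⌊μ - v⌋) ⁻¹' {t} = {u} := by
      ext j
      simp only [Set.mem_preimage, Set.mem_singleton_iff]
      lia
    set g : ℕ → ℝ := fun j =>
      |poissonStein (tpRate μ v) {u} (j + 1) - poissonStein (tpRate μ v) {u} j| with hg
    have h1 : ∑ k ∈ Finset.range M, |tpSteinDiff μ v {t} k| =
        ∑ k ∈ Finset.filter (fun k : ℕ => ⌊μ - v⌋ ≤ (k : ℤ)) (Finset.range M),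
          g ((k : ℤ) - ⌊μ - v⌋).toNat := by
      rw [Finset.sum_filter]
      refine Finset.sum_congr rfl fun k _ => ?_
      split_ifs with hk
      · rw [tpSteinDiff_of_le (j := ((k : ℤ) - ⌊μ - v⌋).toNat) (by lia), he]
      · rw [tpSteinDiff_of_lt (by lia), abs_zero]
    have hinj : Set.InjOn (fun k : ℕ => ((k : ℤ) - ⌊μ - v⌋).toNat)
        (Finset.filter (fun k : ℕ => ⌊μ - v⌋ ≤ (k : ℤ)) (Finset.range M)) := by
      intro a ha b hb hab
      simp only [Finset.coe_filter, Finset.mem_range, Set.mem_ofPred_eq] at ha hb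
      simp only at hab
      lia
    -- The range enlarged by `natAbs` contains all shifted indices, also for a negative shift.
    rw [h1, ← Finset.sum_image (f := g) hinj]
    refine (Finset.sum_le_sum_of_subset_of_nonneg (t := Finset.range (M + ⌊μ - v⌋.natAbs))
      (fun i hi => ?_) (fun _ _ _ => abs_nonneg _)).trans
      ((sum_range_abs_poissonStein_singleton_le (tpRate_pos hv) u _).trans
        (div_le_div_of_nonneg_left zero_le_two hv (le_tpRate hv)))
    simp only [Finset.mem_image, Finset.mem_filter, Finset.mem_range] at hi ⊢
    lia

/-- The Stein equation for `TP(μ, v)`, in the form adapted to the mean `μ` and variance `v`. -/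
lemma tpStein_equation (hv : 0 < v) (A : Set ℤ) (k : ℤ) :
    tpRate μ v * tpSteinDiff μ v A k - (k - μ) *
      poissonStein (tpRate μ v) ((fun j : ℕ => (j : ℤ) + ⌊μ - v⌋) ⁻¹' A) (k - ⌊μ - v⌋).toNat =
    if k < ⌊μ - v⌋ then 0 else A.indicator 1 k - (translatedPoisson μ v).real A := by
  split_ifs with h
  · rw [tpSteinDiff_of_lt h, Int.toNat_of_nonpos (by lia), poissonStein_zero]
    simp
  · obtain ⟨j, hj⟩ := Int.eq_ofNat_of_zero_le (sub_nonneg.2 (not_lt.1 h))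
    have hk : k = j + ⌊μ - v⌋ := by lia
    have heq := poissonStein_equation (tpRate_pos (μ := μ) hv)
      ((fun j : ℕ => (j : ℤ) + ⌊μ - v⌋) ⁻¹' A) j
    have hind : ((fun j : ℕ => (j : ℤ) + ⌊μ - v⌋) ⁻¹' A).indicator (1 : ℕ → ℝ) j =
        A.indicator 1 k := by
      rw [hk]
      rfl
    have hr := coe_tpRate (μ := μ) hv
    have hμ := Int.floor_add_fract (μ - v)
    rw [tpSteinDiff_of_le hk, hj, Int.toNat_natCast,
      translatedPoisson_real_apply, ← hind, ← heq, hk]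
    push_cast
    -- Hence j minus the rate is k - μ, the centred coefficient.
    have : (tpRate μ v : ℝ) = μ - ⌊μ - v⌋ := by linarith
    rw [this]
    ring

end

/-! ### Comparison of the hypergeometric and translated Poisson laws. -/

section

variable {m n N : ℕ} {μ v : ℝ}

/-- Mass of the hypergeometric distribution below the support of the translated Poisson. -/
lemma sum_hypProb_lt_floor_le (hv : 0 < v)
    (hvar : ∑ k ∈ Finset.range (m + 1), hypProb m n N k * ((k : ℝ) - μ) ^ 2 = v) :
    ∑ k ∈ Finset.range (m + 1), hypProb m n N k * (if (k : ℤ) < ⌊μ - v⌋ then 1 else 0) ≤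
      1 / v := by
  -- Chebyshev: k < ⌊μ - v⌋ forces (k - μ)² ≥ v².
  have h : ∀ k ∈ Finset.range (m + 1),
      hypProb m n N k * (if (k : ℤ) < ⌊μ - v⌋ then (1 : ℝ) else 0) ≤
        hypProb m n N k * ((k : ℝ) - μ) ^ 2 / v ^ 2 := by
    intro k _
    have hq := hypProb_nonneg m n N k
    split_ifs with hk
    · rw [mul_div_assoc]
      refine mul_le_mul_of_nonneg_left ?_ hq
      rw [one_le_div (by positivity)]
      have h1 : (k : ℝ) < ⌊μ - v⌋ := by exact_mod_cast hk
      have h2 := Int.floor_le (μ - v)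
      nlinarith
    · rw [mul_zero]
      positivity
  refine (Finset.sum_le_sum h).trans_eq ?_
  rw [← Finset.sum_div, hvar]
  field_simp

lemma abs_hypergeometric_sub_translatedPoisson_le (hm : m ≤ N) (hn : n ≤ N) (hN : 0 < N)
    (hμ : μ = m * n / N) (hv : 0 < v)
    (hvar : ∑ k ∈ Finset.range (m + 1), hypProb m n N k * ((k : ℝ) - μ) ^ 2 = v) (A : Set ℤ) :
    |(hypergeometric m n N).real A - (translatedPoisson μ v).real A| ≤
      ∑ k ∈ Finset.range (m + 1), hypProb m n N k *
        (|((m : ℝ) - k) * (n - k) / N - v| * |tpSteinDiff μ v A k|) + 2 / v := by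
  have hN' : (N : ℝ) ≠ 0 := by exact_mod_cast hN.ne'
  have hsum := sum_hypProb hm hn
  have hq := hypProb_nonneg m n N
  have := isProbabilityMeasure_translatedPoisson μ v
  set b := (translatedPoisson μ v).real A with hb
  have hb0 : 0 ≤ b := measureReal_nonneg
  have hb1 : b ≤ 1 := measureReal_le_one
  set F : ℕ → ℝ := fun k => poissonStein (tpRate μ v)
    ((fun j : ℕ => (j : ℤ) + ⌊μ - v⌋) ⁻¹' A) ((k : ℤ) - ⌊μ - v⌋).toNat with hF
  have hD : ∀ k : ℕ, F (k + 1) - F k = tpSteinDiff μ v A k := fun k => by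
    simp only [hF, tpSteinDiff]
    push_cast
    rfl
  have hstein : ∑ k ∈ Finset.range (m + 1), hypProb m n N k * (((k : ℝ) - μ) * F k) =
      ∑ k ∈ Finset.range (m + 1), hypProb m n N k *
        (((m : ℝ) - k) * (n - k) / N * tpSteinDiff μ v A k) := by
    have h := congrArg (· / (N : ℝ)) (hypProb_stein (m := m) hn F)
    simp only [Finset.sum_div] at h
    convert h using 2 with k _ k _
    · rw [hμ]
      field_simp
    · rw [hD]
      field_simp
  -- Main term, excess of the Poisson rate over v, and the region where the Stein equation reads 0 =
  -- 0.
  have hdecomp : (hypergeometric m n N).real A - b =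
      ∑ k ∈ Finset.range (m + 1), (-(hypProb m n N k *
        ((((m : ℝ) - k) * (n - k) / N - v) * tpSteinDiff μ v A k)) +
          hypProb m n N k * (Int.fract (μ - v) * tpSteinDiff μ v A k) +
        hypProb m n N k * ((if (k : ℤ) < ⌊μ - v⌋ then 1 else 0) * (A.indicator 1 (k : ℤ) - b))) := by
    have e0 : (hypergeometric m n N).real A - b = ∑ k ∈ Finset.range (m + 1),
        hypProb m n N k * (A.indicator 1 (k : ℤ) - b) := by
      simp only [mul_sub, Finset.sum_sub_distrib]
      rw [← Finset.sum_mul, hsum, one_mul, hypergeometric_real_apply]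
    rw [e0, ← sub_eq_zero, ← Finset.sum_sub_distrib]
    rw [← sub_eq_zero, ← Finset.sum_sub_distrib] at hstein
    rw [← neg_eq_zero, ← Finset.sum_neg_distrib] at hstein
    refine (Finset.sum_congr rfl fun k _ => ?_).trans hstein
    have h := tpStein_equation (μ := μ) hv A k
    rw [coe_tpRate hv, Int.cast_natCast] at h
    change _ - _ * F k = _ at h
    split_ifs at h ⊢
    · linear_combination (-hypProb m n N k) * h
    · linear_combination (-hypProb m n N k) * h
  rw [hdecomp]
  have hfr0 := Int.fract_nonneg (μ - v)
  have hfr1 := (Int.fract_lt_one (μ - v)).le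
  have hind : ∀ k : ℤ, |A.indicator (1 : ℤ → ℝ) k - b| ≤ 1 := fun k => by
    by_cases h : k ∈ A <;> simp [h, abs_le] <;> constructor <;> linarith
  calc _ ≤ ∑ k ∈ Finset.range (m + 1), (hypProb m n N k *
        (|((m : ℝ) - k) * (n - k) / N - v| * |tpSteinDiff μ v A k|) +
          hypProb m n N k * (1 / v) +
        hypProb m n N k * (if (k : ℤ) < ⌊μ - v⌋ then 1 else 0)) := by
        refine (Finset.abs_sum_le_sum_abs _ _).trans (Finset.sum_le_sum fun k _ => ?_)
        refine (abs_add_three _ _ _).trans (add_le_add_three ?_ ?_ ?_)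
        · rw [abs_neg, abs_mul, abs_mul, abs_of_nonneg (hq k)]
        · rw [abs_mul, abs_mul, abs_of_nonneg (hq k), abs_of_nonneg hfr0]
          refine mul_le_mul_of_nonneg_left ?_ (hq k)
          exact (mul_le_of_le_one_left (abs_nonneg _) hfr1).trans (abs_tpSteinDiff_le hv A k)
        · rw [abs_mul, abs_mul, abs_of_nonneg (hq k)]
          refine mul_le_mul_of_nonneg_left ?_ (hq k)
          split_ifs
          · simpa using hind k
          · simp
    _ ≤ _ := by
        rw [Finset.sum_add_distrib, Finset.sum_add_distrib, ← Finset.sum_mul, hsum]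
        have h := sum_hypProb_lt_floor_le hv hvar
        have e : (2 : ℝ) / v = 1 / v + 1 / v := by ring
        linarith

/-- Uses |ΔF| ≤ 1/v and E |T - v| ≤ √(E (T - v)²). -/
lemma dTV_hypergeometric_le (hm : m ≤ N) (hn : n ≤ N) (hN : 0 < N)
    (hμ : μ = m * n / N) (hv : 0 < v)
    (hvar : ∑ k ∈ Finset.range (m + 1), hypProb m n N k * ((k : ℝ) - μ) ^ 2 = v) :
    dTV (hypergeometric m n N) (translatedPoisson μ v) ≤
      √(∑ k ∈ Finset.range (m + 1), hypProb m n N k *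
        (((m : ℝ) - k) * (n - k) / N - v) ^ 2) / v + 2 / v := by
  have hq := hypProb_nonneg m n N
  refine ciSup_le fun A => ?_
  refine (abs_hypergeometric_sub_translatedPoisson_le hm hn hN hμ hv hvar A).trans ?_
  gcongr
  calc _ ≤ ∑ k ∈ Finset.range (m + 1), hypProb m n N k *
        (|((m : ℝ) - k) * (n - k) / N - v| * (1 / v)) := by
        refine Finset.sum_le_sum fun k _ => mul_le_mul_of_nonneg_left ?_ (hq k)
        exact mul_le_mul_of_nonneg_left (abs_tpSteinDiff_le hv A k) (abs_nonneg _)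
    _ = (∑ k ∈ Finset.range (m + 1), √(hypProb m n N k) *
        (√(hypProb m n N k) * |((m : ℝ) - k) * (n - k) / N - v|)) / v := by
        rw [Finset.sum_div]
        refine Finset.sum_congr rfl fun k _ => ?_
        rw [← mul_assoc, ← mul_assoc, Real.mul_self_sqrt (hq k)]
        ring
    _ ≤ _ := by
        gcongr
        refine (Real.sum_mul_le_sqrt_mul_sqrt _ _ _).trans_eq ?_
        simp only [mul_pow, Real.sq_sqrt (hq _), sq_abs, sum_hypProb hm hn, Real.sqrt_one, one_mul]

lemma hypProb_le_qMax (hm : m ≤ N) (hn : n ≤ N) {k : ℕ} (hk : k ≤ m) :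
    hypProb m n N k ≤ qMax (hypergeometric m n N) := by
  have := isProbabilityMeasure_hypergeometric hm hn
  have h : (hypergeometric m n N).real {(k : ℤ)} = hypProb m n N k := by
    rw [hypergeometric_real_apply, Finset.sum_eq_single k]
    · simp
    · intro j _ hj
      simp [hj]
    · intro h
      exact absurd (Finset.mem_range.2 (by lia)) h
  rw [← h]
  exact le_ciSup (f := fun k : ℤ => (hypergeometric m n N).real {k})
    ⟨1, by rintro _ ⟨j, rfl⟩; exact measureReal_le_one⟩ (k : ℤ)

lemma dLoc_hypergeometric_le (hm : m ≤ N) (hn : n ≤ N) (hN : 0 < N)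
    (hμ : μ = m * n / N) (hv : 0 < v)
    (hvar : ∑ k ∈ Finset.range (m + 1), hypProb m n N k * ((k : ℝ) - μ) ^ 2 = v) :
    dLoc (hypergeometric m n N) (translatedPoisson μ v) ≤
      2 * √(qMax (hypergeometric m n N) * ∑ k ∈ Finset.range (m + 1), hypProb m n N k *
        (((m : ℝ) - k) * (n - k) / N - v) ^ 2) / v + 2 / v := by
  have hq := hypProb_nonneg m n N
  refine ciSup_le fun t => ?_
  refine (abs_hypergeometric_sub_translatedPoisson_le hm hn hN hμ hv hvar {t}).trans ?_
  gcongr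
  have hQ0 : 0 ≤ qMax (hypergeometric m n N) :=
    (hq 0).trans (hypProb_le_qMax hm hn (Nat.zero_le m))
  -- E (ΔF)² ≤ q_max · sup |ΔF| · ∑ |ΔF| ≤ q_max · 2/v², rounded up to a square.
  have h2 : ∑ k ∈ Finset.range (m + 1), hypProb m n N k * tpSteinDiff μ v {t} k ^ 2 ≤
      qMax (hypergeometric m n N) * (2 / v) ^ 2 := by
    calc _ ≤ ∑ k ∈ Finset.range (m + 1),
          qMax (hypergeometric m n N) * (1 / v * |tpSteinDiff μ v {t} k|) := by
          refine Finset.sum_le_sum fun k hk => ?_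
          refine mul_le_mul (hypProb_le_qMax hm hn (Nat.lt_succ_iff.1 (Finset.mem_range.1 hk))) ?_
            (sq_nonneg _) hQ0
          rw [← sq_abs, sq]
          exact mul_le_mul_of_nonneg_right (abs_tpSteinDiff_le hv _ _) (abs_nonneg _)
      _ ≤ _ := by
          rw [← Finset.mul_sum, ← Finset.mul_sum]
          refine mul_le_mul_of_nonneg_left ?_ hQ0
          calc _ ≤ 1 / v * (2 / v) := mul_le_mul_of_nonneg_left
                (sum_abs_tpSteinDiff_singleton_le hv t _) (by positivity)
            _ ≤ _ := by
                rw [sq]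
                gcongr
                norm_num
  calc _ = ∑ k ∈ Finset.range (m + 1), (√(hypProb m n N k) * |tpSteinDiff μ v {t} k|) *
        (√(hypProb m n N k) * |((m : ℝ) - k) * (n - k) / N - v|) := by
        refine Finset.sum_congr rfl fun k _ => ?_
        nth_rewrite 1 [← Real.mul_self_sqrt (hq k)]
        ring
    _ ≤ √(∑ k ∈ Finset.range (m + 1), hypProb m n N k * tpSteinDiff μ v {t} k ^ 2) *
        √(∑ k ∈ Finset.range (m + 1), hypProb m n N k *
          (((m : ℝ) - k) * (n - k) / N - v) ^ 2) := by
        refine (Real.sum_mul_le_sqrt_mul_sqrt _ _ _).trans_eq ?_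
        simp only [mul_pow, Real.sq_sqrt (hq _), sq_abs]
    _ ≤ √(qMax (hypergeometric m n N) * (2 / v) ^ 2) *
        √(∑ k ∈ Finset.range (m + 1), hypProb m n N k *
          (((m : ℝ) - k) * (n - k) / N - v) ^ 2) := by
        gcongr
    _ = _ := by
        rw [Real.sqrt_mul hQ0, Real.sqrt_mul hQ0, Real.sqrt_sq (by positivity)]
        ring

/-- The first term on the right is T(k) - T(μ), and T(μ) = v(N - 1)/N by the variance formula. -/
lemma balance_sub_variance (hm : m ≤ N) (hn : n ≤ N) (hN : 2 ≤ N) (hμ : μ = m * n / N)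
    (hvar : ∑ k ∈ Finset.range (m + 1), hypProb m n N k * ((k : ℝ) - μ) ^ 2 = v) (k : ℝ) :
    ((m : ℝ) - k) * (n - k) / N - v = (k - μ) * (k + μ - (m + n)) / N - v / N := by
  have h := hypProb_variance hm hn hN
  rw [← hμ, hvar] at h
  have hN2 : (2 : ℝ) ≤ N := by exact_mod_cast hN
  have hN1 : (N : ℝ) - 1 ≠ 0 := by linarith
  have hN0 : (N : ℝ) ≠ 0 := by linarith
  rw [hμ, h]
  field_simp
  ring

lemma hypProb_variance_le (hm : m ≤ N) (hn : n ≤ N) (hN : 2 ≤ N) :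
    (n : ℝ) * m * ((N : ℝ) - n) * ((N : ℝ) - m) / (((N : ℝ) - 1) * (N : ℝ) ^ 2) ≤ N := by
  have hN2 : (2 : ℝ) ≤ N := by exact_mod_cast hN
  have c3 : (m : ℝ) ≤ N := by exact_mod_cast hm
  have c4 : (n : ℝ) ≤ N := by exact_mod_cast hn
  have c5 : (0 : ℝ) ≤ m := Nat.cast_nonneg m
  have c6 : (0 : ℝ) ≤ n := Nat.cast_nonneg n
  rw [div_le_iff₀ (mul_pos (by linarith) (by positivity))]
  have h1 : (n : ℝ) * (N - n) ≤ N ^ 2 / 2 := by nlinarith [sq_nonneg ((N : ℝ) - 2 * n)]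
  have h2 : (m : ℝ) * (N - m) ≤ N ^ 2 / 2 := by nlinarith [sq_nonneg ((N : ℝ) - 2 * m)]
  have h3 := mul_le_mul h1 h2 (mul_nonneg c5 (by linarith)) (by positivity)
  nlinarith [pow_pos (by linarith : (0 : ℝ) < N) 3]

lemma abs_add_mean_sub_le (hn : n ≤ N) (hN : 0 < N) (hμ : μ = m * n / N) {k : ℕ} (hk : k ≤ m) :
    |(k : ℝ) + μ - (m + n)| ≤ m + n := by
  have hN' : (0 : ℝ) < N := by exact_mod_cast hN
  have hμ0 : 0 ≤ μ := by rw [hμ]; positivity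
  have hμm : μ ≤ m := by
    rw [hμ, div_le_iff₀ hN']
    have : (n : ℝ) ≤ N := by exact_mod_cast hn
    gcongr
  have hk' : (k : ℝ) ≤ m := by exact_mod_cast hk
  have hk0 : (0 : ℝ) ≤ k := Nat.cast_nonneg k
  have hn0 : (0 : ℝ) ≤ n := Nat.cast_nonneg n
  rw [abs_le]
  constructor <;> linarith

/-- The variance of `(m - W)(n - W) / N` is at most `((m + n) / N) ^ 2` times that of `W`. -/
lemma sum_balance_sub_sq_le (hm : m ≤ N) (hn : n ≤ N) (hN : 2 ≤ N) (hμ : μ = m * n / N)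
    (hvar : ∑ k ∈ Finset.range (m + 1), hypProb m n N k * ((k : ℝ) - μ) ^ 2 = v) :
    ∑ k ∈ Finset.range (m + 1), hypProb m n N k * (((m : ℝ) - k) * (n - k) / N - v) ^ 2 ≤
      ((m + n) / N) ^ 2 * v := by
  have hb := balance_sub_variance hm hn hN hμ hvar
  have hmean := hypProb_mean_balance (m := m) hn (by lia : 0 < N)
  rw [← hμ, hvar] at hmean
  have h1 := sum_hypProb hm hn
  -- The second moment of (T - v) + v/N; the cross term vanishes because E T = v, and (v/N)² is
  -- dropped below.
  have e : ∑ k ∈ Finset.range (m + 1), hypProb m n N k *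
        ((k - μ) * (k + μ - (m + n)) / N) ^ 2 =
      ∑ k ∈ Finset.range (m + 1), hypProb m n N k * (((m : ℝ) - k) * (n - k) / N - v) ^ 2 +
        2 * (v / N) * (∑ k ∈ Finset.range (m + 1),
          hypProb m n N k * (((m : ℝ) - k) * (n - k) / N) -
            v * ∑ k ∈ Finset.range (m + 1), hypProb m n N k) +
        (v / N) ^ 2 * ∑ k ∈ Finset.range (m + 1), hypProb m n N k := by
    rw [Finset.mul_sum, Finset.mul_sum, ← Finset.sum_sub_distrib, Finset.mul_sum,
      ← Finset.sum_add_distrib, ← Finset.sum_add_distrib]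
    refine Finset.sum_congr rfl fun k _ => ?_
    have h : ((k : ℝ) - μ) * (k + μ - (m + n)) / N = ((m : ℝ) - k) * (n - k) / N - v + v / N := by
      rw [hb]
      ring
    rw [h]
    ring
  rw [hmean, h1, mul_one, sub_self, mul_zero, add_zero, mul_one] at e
  calc _ ≤ ∑ k ∈ Finset.range (m + 1), hypProb m n N k *
        ((k - μ) * (k + μ - (m + n)) / N) ^ 2 := by
        rw [e]
        exact le_add_of_nonneg_right (sq_nonneg _)
    _ ≤ ∑ k ∈ Finset.range (m + 1), ((m + n) / N : ℝ) ^ 2 *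
        (hypProb m n N k * ((k : ℝ) - μ) ^ 2) := by
        refine Finset.sum_le_sum fun k hk => ?_
        have h := abs_add_mean_sub_le hn (by lia : 0 < N) hμ
          (Nat.lt_succ_iff.1 (Finset.mem_range.1 hk))
        have h' : ((k : ℝ) + μ - (m + n)) ^ 2 ≤ (m + n) ^ 2 :=
          sq_le_sq.2 (h.trans (le_abs_self _))
        rw [div_pow, div_pow, mul_pow]
        calc _ = hypProb m n N k * ((k : ℝ) - μ) ^ 2 / N ^ 2 * (k + μ - (m + n)) ^ 2 := by ring
          _ ≤ hypProb m n N k * ((k : ℝ) - μ) ^ 2 / N ^ 2 * (m + n) ^ 2 :=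
            mul_le_mul_of_nonneg_left h' (div_nonneg
              (mul_nonneg (hypProb_nonneg _ _ _ _) (sq_nonneg _)) (sq_nonneg _))
          _ = _ := by ring
    _ = _ := by rw [← Finset.mul_sum, hvar]

/-- Since `|k - μ| P[W = k]` is bounded, the local distance is of order `1 / v`. -/
lemma dLoc_hypergeometric_le_div (hm : m ≤ N) (hn : n ≤ N) (hN : 2 ≤ N)
    (hμ : μ = m * n / N) (hv : 0 < v)
    (hvar : ∑ k ∈ Finset.range (m + 1), hypProb m n N k * ((k : ℝ) - μ) ^ 2 = v) :
    dLoc (hypergeometric m n N) (translatedPoisson μ v) ≤ 8 / v := by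
  have hq := hypProb_nonneg m n N
  have hN' : (0 : ℝ) < N := by exact_mod_cast (by lia : 0 < N)
  have hvN : v ≤ N := by
    rw [← hvar, hμ, hypProb_variance hm hn hN]
    exact hypProb_variance_le hm hn hN
  refine ciSup_le fun t => ?_
  refine (abs_hypergeometric_sub_translatedPoisson_le hm hn (by lia) hμ hv hvar {t}).trans ?_
  have c3 : (m : ℝ) ≤ N := by exact_mod_cast hm
  have c4 : (n : ℝ) ≤ N := by exact_mod_cast hn
  -- As m + n ≤ 2N and v ≤ N, |T(k) - v| ≤ 2|k - μ| + 1, and |k - μ| P[W = k] ≤ 1.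
  have hkey : ∀ k ≤ m, hypProb m n N k * |((m : ℝ) - k) * (n - k) / N - v| ≤ 3 := by
    intro k hk
    rw [balance_sub_variance hm hn hN hμ hvar]
    have h1 := abs_add_mean_sub_le hn (by lia : 0 < N) hμ hk
    have h2 := abs_sub_mean_mul_hypProb_le hm hn (by lia : 0 < N) hk
    rw [← hμ] at h2
    have h3 : hypProb m n N k ≤ 1 := by
      rw [← sum_hypProb hm hn]
      exact Finset.single_le_sum (fun i _ => hq i) (Finset.mem_range.2 (by lia))
    have h4 : |((k : ℝ) - μ) * (k + μ - (m + n)) / N - v / N| ≤ 2 * |(k : ℝ) - μ| + 1 := by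
      refine (abs_sub _ _).trans (add_le_add ?_ ?_)
      · rw [abs_div, abs_mul, abs_of_pos hN', div_le_iff₀ hN']
        calc _ ≤ |(k : ℝ) - μ| * (N + N) :=
              mul_le_mul_of_nonneg_left (by linarith) (abs_nonneg _)
          _ = _ := by ring
      · rw [abs_of_nonneg (by positivity), div_le_one hN']
        exact hvN
    calc _ ≤ hypProb m n N k * (2 * |(k : ℝ) - μ| + 1) := mul_le_mul_of_nonneg_left h4 (hq k)
      _ = 2 * (|(k : ℝ) - μ| * hypProb m n N k) + hypProb m n N k := by ring
      _ ≤ 3 := by linarith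
  calc _ ≤ ∑ k ∈ Finset.range (m + 1), 3 * |tpSteinDiff μ v {t} k| + 2 / v := by
        refine add_le_add (Finset.sum_le_sum fun k hk => ?_) le_rfl
        rw [← mul_assoc]
        exact mul_le_mul_of_nonneg_right (hkey k (Nat.lt_succ_iff.1 (Finset.mem_range.1 hk)))
          (abs_nonneg _)
    _ ≤ 3 * (2 / v) + 2 / v := by
        rw [← Finset.mul_sum]
        have := sum_abs_tpSteinDiff_singleton_le (μ := μ) hv t (m + 1)
        linarith
    _ = _ := by ring

end

/-! ### Bounds in terms of the variance alone, and the asymptotics. -/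

lemma dTV_nonneg (P Q : Measure ℤ) : 0 ≤ dTV P Q := Real.iSup_nonneg fun _ => abs_nonneg _

lemma dLoc_nonneg (P Q : Measure ℤ) : 0 ≤ dLoc P Q := Real.iSup_nonneg fun _ => abs_nonneg _

section

variable {m n N : ℕ}

lemma dTV_hypergeometric_matchingTP_le (hm : m ≤ N) (hn : n ≤ N) (hN : 2 ≤ N)
    (hv : 0 < lawVar (hypergeometric m n N)) :
    dTV (hypergeometric m n N) (matchingTP (hypergeometric m n N)) ≤
      2 / √(lawVar (hypergeometric m n N)) + 2 / lawVar (hypergeometric m n N) := by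
  have hN' : (0 : ℝ) < N := by exact_mod_cast (by lia : 0 < N)
  have hvar := (lawVar_hypergeometric hm hn (by lia : 0 < N)).symm
  have hμ := lawMean_hypergeometric hm hn (by lia : 0 < N)
  rw [← hμ] at hvar
  unfold matchingTP
  set v := lawVar (hypergeometric m n N)
  refine (dTV_hypergeometric_le hm hn (by lia) hμ hv hvar).trans ?_
  gcongr ?_ + _
  have h := sum_balance_sub_sq_le hm hn hN hμ hvar
  have h' : ((m + n) / N : ℝ) ^ 2 * v ≤ 2 ^ 2 * v := by
    have c3 : (m : ℝ) ≤ N := by exact_mod_cast hm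
    have c4 : (n : ℝ) ≤ N := by exact_mod_cast hn
    gcongr
    rw [div_le_iff₀ hN']
    linarith
  calc _ ≤ √(2 ^ 2 * v) / v := by
        gcongr
        exact h.trans h'
    _ = 2 / √v := by
        rw [Real.sqrt_mul (by norm_num), Real.sqrt_sq (by norm_num), mul_div_assoc,
          Real.sqrt_div_self]
        ring

lemma dLoc_hypergeometric_matchingTP_le (hm : m ≤ N) (hn : n ≤ N) (hN : 2 ≤ N)
    (hv : 0 < lawVar (hypergeometric m n N)) :
    dLoc (hypergeometric m n N) (matchingTP (hypergeometric m n N)) ≤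
      8 / lawVar (hypergeometric m n N) := by
  have hvar := (lawVar_hypergeometric hm hn (by lia : 0 < N)).symm
  have hμ := lawMean_hypergeometric hm hn (by lia : 0 < N)
  rw [← hμ] at hvar
  exact dLoc_hypergeometric_le_div hm hn hN hμ hv hvar

end

lemma hypergeometric_asymptotics (N m : ℕ → ℕ) (hn : ∀ᶠ n in atTop, n ≤ N n)
    (hm : ∀ᶠ n in atTop, m n ≤ N n)
    (hv : (fun n : ℕ => (n : ℝ)) =O[atTop] (fun n => lawVar (hypergeometric (m n) n (N n)))) :
    (fun n => dTV (hypergeometric (m n) n (N n)) (matchingTP (hypergeometric (m n) n (N n))))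
      =O[atTop] (fun n : ℕ => (n : ℝ) ^ (-(1 / 2) : ℝ)) ∧
    (fun n => dLoc (hypergeometric (m n) n (N n)) (matchingTP (hypergeometric (m n) n (N n))))
      =O[atTop] (fun n : ℕ => (n : ℝ)⁻¹) := by
  obtain ⟨c, hc, hcv⟩ := hv.exists_pos
  have hlow : ∀ᶠ n : ℕ in atTop, m n ≤ N n ∧ n ≤ N n ∧ 2 ≤ N n ∧ (1 : ℝ) ≤ n ∧
      n / c ≤ lawVar (hypergeometric (m n) n (N n)) := by
    filter_upwards [hn, hm, hcv.bound, eventually_ge_atTop 2] with n h1 h2 h3 h4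
    refine ⟨h2, h1, h4.trans h1, by exact_mod_cast (by lia : 1 ≤ n), ?_⟩
    rw [Real.norm_of_nonneg (Nat.cast_nonneg n),
      Real.norm_of_nonneg (show 0 ≤ lawVar _ from variance_nonneg _ _)] at h3
    rwa [div_le_iff₀' hc]
  constructor
  · refine IsBigO.of_bound (2 * √c + 2 * c) ?_
    filter_upwards [hlow] with n ⟨h1, h2, h3, h4, h5⟩
    have hn0 : (0 : ℝ) < n := by linarith
    have hnc : 0 < (n : ℝ) / c := by positivity
    have hv0 := hnc.trans_le h5
    rw [Real.norm_of_nonneg (dTV_nonneg _ _), Real.norm_of_nonneg (by positivity),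
      Real.rpow_neg hn0.le, ← Real.sqrt_eq_rpow]
    refine (dTV_hypergeometric_matchingTP_le h1 h2 h3 hv0).trans ?_
    have hs : √(n : ℝ) ≤ n := Real.sqrt_le_iff.2 ⟨hn0.le, by nlinarith⟩
    have hsp : 0 < √(n : ℝ) := Real.sqrt_pos.2 hn0
    calc _ ≤ 2 / √((n : ℝ) / c) + 2 / ((n : ℝ) / c) := by gcongr
      _ = 2 * √c * (√(n : ℝ))⁻¹ + 2 * c * (n : ℝ)⁻¹ := by
          rw [Real.sqrt_div hn0.le]
          field_simp
      _ ≤ 2 * √c * (√(n : ℝ))⁻¹ + 2 * c * (√(n : ℝ))⁻¹ := by gcongr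
      _ = _ := by ring
  · refine IsBigO.of_bound (8 * c) ?_
    filter_upwards [hlow] with n ⟨h1, h2, h3, h4, h5⟩
    have hn0 : (0 : ℝ) < n := by linarith
    have hnc : 0 < (n : ℝ) / c := by positivity
    have hv0 := hnc.trans_le h5
    rw [Real.norm_of_nonneg (dLoc_nonneg _ _), Real.norm_of_nonneg (by positivity)]
    refine (dLoc_hypergeometric_matchingTP_le h1 h2 h3 hv0).trans ?_
    calc _ ≤ 8 / ((n : ℝ) / c) := by gcongr
      _ = _ := by field_simp

/-! ### The exchangeable pair. -/

noncomputable section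

/-- The probability that moving a random ball to a random admissible urn increases `W = k`. -/
def ballUp (m n N : ℕ) (k : ℤ) : ℝ := ((m : ℝ) - k) * (n - k) / (m * ((N : ℝ) - m + 1))

/-- The probability that moving a random ball to a random admissible urn decreases `W = k`. -/
def ballDown (m n N : ℕ) (k : ℤ) : ℝ := k * ((N : ℝ) - n - m + k) / (m * ((N : ℝ) - m + 1))

/-- The law of two consecutive states of the stationary chain on `ℤ` which moves a random ball to
a random admissible urn. -/
def ballPair (m n N : ℕ) : Measure (ℤ × ℤ) :=
  (∑ k ∈ Finset.range (m + 1),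
      ENNReal.ofReal (hypProb m n N k * ballUp m n N k) • Measure.dirac ((k : ℤ), (k : ℤ) + 1)) +
    (∑ k ∈ Finset.range (m + 1),
      ENNReal.ofReal (hypProb m n N k * ballDown m n N k) • Measure.dirac ((k : ℤ), (k : ℤ) - 1)) +
    ∑ k ∈ Finset.range (m + 1),
      ENNReal.ofReal (hypProb m n N k * (1 - ballUp m n N k - ballDown m n N k)) •
        Measure.dirac ((k : ℤ), (k : ℤ))

end

section

variable {m n N : ℕ}

lemma integrable_sum_smul_dirac {α : Type*} [MeasurableSpace α] [MeasurableSingletonClass α]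
    {ι : Type*} (s : Finset ι) (c : ι → ℝ) (x : ι → α) (f : α → ℝ) :
    Integrable f (∑ i ∈ s, ENNReal.ofReal (c i) • Measure.dirac (x i)) :=
  integrable_finsetSum_measure.2 fun _ _ =>
    (integrable_dirac (by simp)).smul_measure ENNReal.ofReal_ne_top

lemma integrable_ballPair (m n N : ℕ) (f : ℤ × ℤ → ℝ) : Integrable f (ballPair m n N) :=
  ((integrable_sum_smul_dirac _ _ _ _).add_measure
    (integrable_sum_smul_dirac _ _ _ _)).add_measure (integrable_sum_smul_dirac _ _ _ _)

/-- The transition weights can be negative off the support of W; only their products with the point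
probabilities must be nonnegative, as `ENNReal.ofReal` truncates. -/
lemma hypProb_mul_nonneg {k : ℕ} {x : ℝ} (h : k ≤ n → m - k ≤ N - n → 0 ≤ x) :
    0 ≤ hypProb m n N k * x := by
  rcases eq_or_ne (hypProb m n N k) 0 with h0 | h0
  · rw [h0, zero_mul]
  · exact mul_nonneg (hypProb_nonneg _ _ _ _)
      (h (le_of_hypProb_ne_zero h0).1 (le_of_hypProb_ne_zero h0).2)

lemma integral_ballPair (hm0 : 0 < m) (hm : m ≤ N) (hn : n ≤ N) (f : ℤ × ℤ → ℝ) :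
    ∫ x, f x ∂(ballPair m n N) = ∑ k ∈ Finset.range (m + 1), hypProb m n N k *
      (ballUp m n N k * f (k, k + 1) + ballDown m n N k * f (k, k - 1) +
        (1 - ballUp m n N k - ballDown m n N k) * f (k, k)) := by
  have c1 : (0 : ℝ) < m := by exact_mod_cast hm0
  have c2 : (m : ℝ) ≤ N := by exact_mod_cast hm
  have c3 : (n : ℝ) ≤ N := by exact_mod_cast hn
  have c4 : (0 : ℝ) < m * ((N : ℝ) - m + 1) := mul_pos c1 (by linarith)
  have hcast : ∀ k : ℕ, k ≤ m → m - k ≤ N - n → (0 : ℝ) ≤ (N : ℝ) - n - m + k := by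
    intro k hk h
    have : m + n ≤ N + k := by lia
    have : (m : ℝ) + n ≤ N + k := by exact_mod_cast this
    linarith
  unfold ballPair
  rw [integral_add_measure ((integrable_sum_smul_dirac _ _ _ _).add_measure
    (integrable_sum_smul_dirac _ _ _ _)) (integrable_sum_smul_dirac _ _ _ _),
    integral_add_measure (integrable_sum_smul_dirac _ _ _ _) (integrable_sum_smul_dirac _ _ _ _),
    integral_sum_smul_dirac, integral_sum_smul_dirac, integral_sum_smul_dirac,
    ← Finset.sum_add_distrib, ← Finset.sum_add_distrib]
  · exact Finset.sum_congr rfl fun k _ => by ring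
  all_goals
    intro k hk
    have hkm : k ≤ m := Nat.lt_succ_iff.1 (Finset.mem_range.1 hk)
    have hkm' : (k : ℝ) ≤ m := by exact_mod_cast hkm
    have hk0 : (0 : ℝ) ≤ k := Nat.cast_nonneg k
    refine hypProb_mul_nonneg fun h1 h2 => ?_
    have h1' : (k : ℝ) ≤ n := by exact_mod_cast h1
    have h2' := hcast k hkm h2
    simp only [ballUp, ballDown, Int.cast_natCast]
  -- On the support n - k and N - n - m + k are both at most N - m, so the two weights add up to at
  -- most m(N - m).
  · rw [sub_sub, ← add_div, sub_nonneg, div_le_one c4]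
    nlinarith
  · exact div_nonneg (mul_nonneg hk0 h2') c4.le
  · exact div_nonneg (mul_nonneg (by linarith) (by linarith)) c4.le

lemma ballPair_real_apply (hm0 : 0 < m) (hm : m ≤ N) (hn : n ≤ N) (A : Set (ℤ × ℤ)) :
    (ballPair m n N).real A = ∑ k ∈ Finset.range (m + 1), hypProb m n N k *
      (ballUp m n N k * A.indicator 1 ((k : ℤ), (k : ℤ) + 1) +
        ballDown m n N k * A.indicator 1 ((k : ℤ), (k : ℤ) - 1) +
        (1 - ballUp m n N k - ballDown m n N k) * A.indicator 1 ((k : ℤ), (k : ℤ))) := by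
  rw [← integral_ballPair hm0 hm hn, integral_indicator_one (MeasurableSet.of_discrete)]

lemma isProbabilityMeasure_ballPair (hm0 : 0 < m) (hm : m ≤ N) (hn : n ≤ N) :
    IsProbabilityMeasure (ballPair m n N) := by
  have h := ballPair_real_apply hm0 hm hn Set.univ
  simp only [Set.indicator_univ, Pi.one_apply, mul_one] at h
  have e : ∀ a b : ℝ, a + b + (1 - a - b) = 1 := fun a b => by ring
  simp only [e, mul_one, sum_hypProb hm hn] at h
  exact ⟨(ENNReal.toReal_eq_one_iff _).1 h⟩

lemma measure_ext_of_real {α : Type*} [MeasurableSpace α] {P Q : Measure α} [IsFiniteMeasure P]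
    [IsFiniteMeasure Q] (h : ∀ A, MeasurableSet A → P.real A = Q.real A) : P = Q :=
  Measure.ext fun A hA => (measureReal_eq_measureReal_iff).1 (h A hA)

lemma map_fst_ballPair (hm0 : 0 < m) (hm : m ≤ N) (hn : n ≤ N) :
    (ballPair m n N).map Prod.fst = hypergeometric m n N := by
  have := isProbabilityMeasure_ballPair hm0 hm hn
  have := isProbabilityMeasure_hypergeometric hm hn
  refine measure_ext_of_real fun A hA => ?_
  rw [map_measureReal_apply measurable_fst hA, ballPair_real_apply hm0 hm hn,
    hypergeometric_real_apply]
  refine Finset.sum_congr rfl fun k _ => ?_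
  have e : ∀ y, (Prod.fst ⁻¹' A).indicator (1 : ℤ × ℤ → ℝ) ((k : ℤ), y) =
      A.indicator 1 (k : ℤ) := fun _ => rfl
  simp only [e]
  ring

lemma ballPair_exchangeable (hm0 : 0 < m) (hm : m ≤ N) (hn : n ≤ N) :
    IsExchangeablePair (ballPair m n N) Prod.fst Prod.snd := by
  refine ⟨measurable_fst, measurable_snd, ?_⟩
  have := isProbabilityMeasure_ballPair hm0 hm hn
  refine measure_ext_of_real fun A hA => ?_
  rw [map_measureReal_apply (by fun_prop) hA, map_measureReal_apply (by fun_prop) hA,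
    ballPair_real_apply hm0 hm hn, ballPair_real_apply hm0 hm hn]
  have h : ∀ g : ℤ → ℝ, ∑ k ∈ Finset.range (m + 1),
      hypProb m n N k * (ballUp m n N k * g (k + 1)) =
      ∑ k ∈ Finset.range (m + 1), hypProb m n N k * (ballDown m n N k * g k) := by
    intro g
    have h := congrArg (· / (m * ((N : ℝ) - m + 1)))
      (sum_hypProb_balance (m := m) hn (fun k => g k))
    simp only [Finset.sum_div] at h
    convert h using 2 with k _ k _
    · simp only [ballUp]
      push_cast
      ring
    · simp only [ballDown]
      push_cast
      ring
  simp only [mul_add, Finset.sum_add_distrib]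
  set f : ℤ → ℤ → ℝ := fun x y => A.indicator 1 (x, y) with hf
  have e1 : ∀ x y, ((fun ω : ℤ × ℤ => (ω.1, ω.2)) ⁻¹' A).indicator (1 : ℤ × ℤ → ℝ) (x, y) =
      f x y := fun _ _ => rfl
  have e2 : ∀ x y, ((fun ω : ℤ × ℤ => (ω.2, ω.1)) ⁻¹' A).indicator (1 : ℤ × ℤ → ℝ) (x, y) =
      f y x := fun _ _ => rfl
  simp only [e1, e2]
  -- Detailed balance exchanges the up and down atoms; the diagonal part is already symmetric.
  have h1 := h (fun k => f (k - 1) k)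
  have h2 := h (fun k => f k (k - 1))
  simp only [add_sub_cancel_right] at h1 h2
  rw [h1, h2, add_comm (∑ k ∈ Finset.range (m + 1), _)
    (∑ k ∈ Finset.range (m + 1), hypProb m n N k * (ballDown m n N k * f k (k - 1)))]

/-- The left side of `h` is the mean of F after one step from k, so both integrals over an event of
σ(W) agree term by term. -/
lemma condExp_ballPair (hm0 : 0 < m) (hm : m ≤ N) (hn : n ≤ N) (F : ℤ × ℤ → ℝ) (g : ℤ → ℝ)
    (h : ∀ k : ℤ, ballUp m n N k * F (k, k + 1) + ballDown m n N k * F (k, k - 1) +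
      (1 - ballUp m n N k - ballDown m n N k) * F (k, k) = g k) :
    (ballPair m n N)[F | MeasurableSpace.comap Prod.fst inferInstance] =ᵐ[ballPair m n N]
      fun x => g x.1 := by
  have := isProbabilityMeasure_ballPair hm0 hm hn
  symm
  refine ae_eq_condExp_of_forall_setIntegral_eq measurable_fst.comap_le
    (integrable_ballPair _ _ _ _) (fun _ _ _ => (integrable_ballPair _ _ _ _).integrableOn) ?_ ?_
  · rintro _ ⟨B, hB, rfl⟩ -
    rw [← integral_indicator (measurable_fst hB), ← integral_indicator (measurable_fst hB),
      integral_ballPair hm0 hm hn, integral_ballPair hm0 hm hn]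
    refine Finset.sum_congr rfl fun k _ => ?_
    by_cases hk : (k : ℤ) ∈ B
    · simp only [Set.indicator, Set.mem_preimage, hk, if_true]
      rw [h]
      ring
    · simp [Set.indicator, Set.mem_preimage, hk]
  · have hg : Measurable g := Measurable.of_discrete
    exact (hg.comp (comap_measurable Prod.fst)).aestronglyMeasurable

lemma upProb_ballPair (hm0 : 0 < m) (hm : m ≤ N) (hn : n ≤ N) :
    upProb (ballPair m n N) Prod.fst Prod.snd =ᵐ[ballPair m n N] fun x => ballUp m n N x.1 := by
  refine condExp_ballPair hm0 hm hn _ _ fun k => ?_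
  simp only [Set.indicator, Set.mem_ofPred_eq, if_true, if_neg (by lia : ¬k - 1 = k + 1),
    if_neg (by lia : ¬k = k + 1)]
  ring

/-- The drift, up minus down, is (mn - Nk)/(m(N - m + 1)) = -λ(k - μ). -/
lemma regression_ballPair (hm0 : 0 < m) (hm : m ≤ N) (hn : n ≤ N) :
    RegressionCondition (ballPair m n N) Prod.fst Prod.snd ((m : ℝ) * n / N)
      (N / (m * ((N : ℝ) - m + 1))) (fun _ => 0) := by
  have c1 : (0 : ℝ) < m := by exact_mod_cast hm0
  have c2 : (m : ℝ) ≤ N := by exact_mod_cast hm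
  have c3 : (N : ℝ) - m + 1 ≠ 0 := by linarith
  have c4 : (N : ℝ) ≠ 0 := by linarith
  refine condExp_ballPair hm0 hm hn (fun x => (x.2 : ℝ) - (m : ℝ) * n / N)
    (fun k => (1 - N / (m * ((N : ℝ) - m + 1))) * ((k : ℝ) - (m : ℝ) * n / N) + 0) fun k => ?_
  simp only [ballUp, ballDown]
  push_cast
  field_simp
  ring

lemma ballPair_step (hm0 : 0 < m) (hm : m ≤ N) (hn : n ≤ N) :
    ∀ᵐ x ∂(ballPair m n N), x.2 - x.1 ∈ ({-1, 0, 1} : Set ℤ) := by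
  have := isProbabilityMeasure_ballPair hm0 hm hn
  rw [ae_iff, ← measureReal_eq_zero_iff, ballPair_real_apply hm0 hm hn]
  refine Finset.sum_eq_zero fun k _ => ?_
  simp [Set.indicator]

/-- Here S = λT and E T = v, so Var S = λ² E (T - v)². -/
lemma variance_upProb_ballPair (hm0 : 0 < m) (hm : m ≤ N) (hn : n ≤ N) :
    Var[upProb (ballPair m n N) Prod.fst Prod.snd; ballPair m n N] =
      (N / (m * ((N : ℝ) - m + 1))) ^ 2 * ∑ k ∈ Finset.range (m + 1), hypProb m n N k *
        (((m : ℝ) - k) * (n - k) / N - lawVar (hypergeometric m n N)) ^ 2 := by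
  have hN : 0 < N := by lia
  have hN' : (N : ℝ) ≠ 0 := by exact_mod_cast hN.ne'
  have hmean := hypProb_mean_balance (m := m) hn hN
  rw [← lawVar_hypergeometric hm hn hN] at hmean
  have hup : ∀ k : ℕ, ballUp m n N k =
      N / (m * ((N : ℝ) - m + 1)) * (((m : ℝ) - k) * (n - k) / N) := fun k => by
    simp only [ballUp, Int.cast_natCast]
    field_simp
  rw [variance_congr (upProb_ballPair hm0 hm hn),
    ← Function.comp_def (ballUp m n N) Prod.fst, ← variance_map
      (Measurable.of_discrete).aemeasurable measurable_fst.aemeasurable,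
    map_fst_ballPair hm0 hm hn, variance_hypergeometric]
  have e : ∑ k ∈ Finset.range (m + 1), hypProb m n N k * ballUp m n N k =
      N / (m * ((N : ℝ) - m + 1)) * lawVar (hypergeometric m n N) := by
    rw [← hmean, Finset.mul_sum]
    refine Finset.sum_congr rfl fun k _ => ?_
    rw [hup]
    ring
  rw [e, Finset.mul_sum]
  refine Finset.sum_congr rfl fun k _ => ?_
  rw [hup]
  ring

end

/-! ### Assembly. -/

theorem theorem4p2 :
    (∀ m n N : ℕ, 0 < m → m < N → 0 < n → n < N →
      ∀ (ν : Measure ℤ) (μ v l : ℝ), ν = hypergeometric m n N → μ = lawMean ν → v = lawVar ν →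
        l = (N : ℝ) / ((m : ℝ) * ((N : ℝ) - m + 1)) →
      v = (n : ℝ) * m * ((N : ℝ) - n) * ((N : ℝ) - m) / (((N : ℝ) - 1) * (N : ℝ) ^ 2) ∧
      0 < l ∧ (2 ≤ m → l < 1) ∧
      ∃ (Ω : Type) (_ : MeasurableSpace Ω) (P : Measure Ω) (W W' : Ω → ℤ),
        IsProbabilityMeasure P ∧ P.map W = ν ∧
        IsExchangeablePair P W W' ∧
        RegressionCondition P W W' μ l (fun _ => 0) ∧
        (∀ᵐ ω ∂P, W' ω - W ω ∈ ({-1, 0, 1} : Set ℤ)) ∧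
        dTV ν (translatedPoisson μ v)
          ≤ √(Var[upProb P W W'; P]) / (l * v) + 2 / v ∧
        dLoc ν (translatedPoisson μ v)
          ≤ 2 * √(qMax ν * Var[upProb P W W'; P]) / (l * v) + 2 / v ∧
        Var[upProb P W W'; P]
          ≤ ((n : ℝ) * m * ((m : ℝ) + n) ^ 2 * ((N : ℝ) - n) * ((N : ℝ) - m)) /
            ((m : ℝ) ^ 2 * ((N : ℝ) - m + 1) ^ 2 * ((N : ℝ) - 1) * (N : ℝ) ^ 2)) ∧
    (∀ N m : ℕ → ℕ, (∀ᶠ n in atTop, n ≤ N n) → (∀ᶠ n in atTop, m n ≤ N n) →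
      (fun n => (N n : ℝ)) =Θ[atTop] (fun n : ℕ => (n : ℝ)) →
      (fun n => (m n : ℝ)) =Θ[atTop] (fun n : ℕ => (n : ℝ)) →
      (fun n => lawVar (hypergeometric (m n) n (N n))) =Θ[atTop] (fun n : ℕ => (n : ℝ)) →
      (fun n => dTV (hypergeometric (m n) n (N n)) (matchingTP (hypergeometric (m n) n (N n))))
        =O[atTop] (fun n : ℕ => (n : ℝ) ^ (-(1 / 2) : ℝ)) ∧
      (fun n => dLoc (hypergeometric (m n) n (N n)) (matchingTP (hypergeometric (m n) n (N n))))
        =O[atTop] (fun n : ℕ => (n : ℝ)⁻¹)) := by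
  refine ⟨?_, fun N m hn hm _ _ hv => hypergeometric_asymptotics N m hn hm hv.2⟩
  intro m n N hm0 hmN hn0 hnN ν μ v l hν hμ hv hl
  have hN : 2 ≤ N := by lia
  have hmean := lawMean_hypergeometric hmN.le hnN.le (by lia : 0 < N)
  have hvar := lawVar_hypergeometric hmN.le hnN.le (by lia : 0 < N)
  have hform := hypProb_variance hmN.le hnN.le hN
  rw [← hvar] at hform
  have hV := variance_upProb_ballPair hm0 hmN.le hnN.le
  subst hν
  rw [← hμ] at hmean
  rw [← hmean, ← hv] at hvar
  rw [← hv] at hform hV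
  rw [← hl] at hV
  have c0 : (0 : ℝ) < m := by exact_mod_cast hm0
  have c1 : (0 : ℝ) < n := by exact_mod_cast hn0
  have c2 : (0 : ℝ) < (N : ℝ) - m := sub_pos.2 (by exact_mod_cast hmN)
  have c3 : (0 : ℝ) < (N : ℝ) - n := sub_pos.2 (by exact_mod_cast hnN)
  have c4 : (2 : ℝ) ≤ N := by exact_mod_cast hN
  have c5 : (0 : ℝ) < (N : ℝ) - 1 := by linarith
  have c6 : (0 : ℝ) < (N : ℝ) - m + 1 := by linarith
  have hv0 : 0 < v := by
    rw [hform]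
    positivity
  have hl0 : 0 < l := by
    rw [hl]
    positivity
  have hG : √(l ^ 2 * ∑ k ∈ Finset.range (m + 1), hypProb m n N k *
      (((m : ℝ) - k) * (n - k) / N - v) ^ 2) = l * √(∑ k ∈ Finset.range (m + 1),
        hypProb m n N k * (((m : ℝ) - k) * (n - k) / N - v) ^ 2) := by
    rw [Real.sqrt_mul (sq_nonneg _), Real.sqrt_sq hl0.le]
  refine ⟨hform, hl0, fun h2 => ?_, ℤ × ℤ, inferInstance, ballPair m n N, Prod.fst, Prod.snd,
    isProbabilityMeasure_ballPair hm0 hmN.le hnN.le, map_fst_ballPair hm0 hmN.le hnN.le,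
    ballPair_exchangeable hm0 hmN.le hnN.le, ?_, ballPair_step hm0 hmN.le hnN.le, ?_, ?_, ?_⟩
  -- The claim is m(N - m + 1) - N = (m - 1)(N - m) > 0.
  · have h2' : (2 : ℝ) ≤ m := by exact_mod_cast h2
    rw [hl, div_lt_one (by positivity)]
    nlinarith
  · rw [hl, hmean]
    exact regression_ballPair hm0 hmN.le hnN.le
  · refine (dTV_hypergeometric_le hmN.le hnN.le (by lia) hmean hv0 hvar.symm).trans_eq ?_
    -- The factor λ in √(Var S) cancels the one in the denominator.
    rw [hV, hG, mul_div_mul_left _ _ hl0.ne']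
  · refine (dLoc_hypergeometric_le hmN.le hnN.le (by lia) hmean hv0 hvar.symm).trans_eq ?_
    rw [hV, mul_left_comm, Real.sqrt_mul (sq_nonneg l), Real.sqrt_sq hl0.le, mul_left_comm 2 l,
      mul_div_mul_left _ _ hl0.ne']
  · rw [hV]
    refine (mul_le_mul_of_nonneg_left
      (sum_balance_sub_sq_le hmN.le hnN.le hN hmean hvar.symm) (sq_nonneg l)).trans_eq ?_
    rw [hform, hl]
    field_simp
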